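/- **Theorem (numerical precession of Störmer–Verlet).** Let $X:\mathbb R\to\mathbb R^2$ be a solution of the Kepler problem $\ddot X=-X/|X|^3$ whose orbit is an ellipse with semimajor axis $a$ and semiminor axis $b$, $0<b<a$. Let $T$ be its (minimal) period, $\mathbb L=X_1\dot X_2-\dot X_1X_2$ its angular momentum, and let $$R(x,v)=|v|^2x-\langle x,v\rangle v-\frac{x}{|x|}$$ be the Laplace–Runge–Lenz (LRL) vector. The change in angle of the LRL vector of a numerical solution, or of a solution of a perturbed Kepler problem, over a time interval of length $T$ is called its precession rate. Then the precession rate of the Störmer–Verlet method with step size $h$ is $$-\operatorname{sgn}(\mathbb L)\,\frac{\pi}{24}\left(15\frac{a^3}{b^6}-3\frac{a}{b^4}\right)h^2+\mathcal O(h^4)\qquad(h\to0^+).$$ Precisely, for every $K$ there are $C$ and $h_0>0$ such that for $0<h<h_0$ the following rates differ from the leading term by at most $Ch^4$: 1. *The numerical solution.* Let $(x_k)_{k\ge0}$ satisfy $\frac{x_{k+1}-2x_k+x_{k-1}}{h^2}=-\frac{x_k}{|x_k|^3}$ for $k\ge1$, with discrete momentum $p_k=\frac{x_{k+1}-x_k}{h}+\frac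 h2\frac{x_k}{|x_k|^3}$, and suppose $|x_0-X(0)|\le Kh^2$ and $|p_0-\dot X(0)|\le Kh^2$. Let $\omega_n$ be the sum over $k<n$ of the signed angles (in $(-\pi,\pi]$) from $R(x_k,p_k)$ to $R(x_{k+1},p_{k+1})$. The precession rate is the value at time $T$ of the piecewise linear function of time that takes the value $\omega_n$ at time $nh$ (so it is $\omega_N$ if $T=Nh$). 2. *The modified Lagrangian.* Let $x:[0,T]\to\mathbb R^2\setminus\{0\}$ be a $C^2$ solution of the Euler–Lagrange equation of the modified Lagrangian of second order accuracy of the method, $$\mathcal L_{\mathrm{mod},2}(x,\dot x)=\frac12|\dot x|^2+\frac1{|x|}+\frac{h^2}{24}\left(\frac1{|x|^4}-2\frac{|\dot x|^2}{|x|^3}+6\frac{\langle x,\dot x\rangle^2}{|x|^5}\right),$$ with $|x(0)-X(0)|\le Kh^2$ and $|\dot x(0)-\dot X(0)|\le Kh^2$. The precession rate is $\theta(T)-\theta(0)$, where $\theta$ is any continuous angle of $R(x(t),\dot x(t))$ on $[0,T]$. -/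

import Mathlib

open scoped RealInnerProductSpace

noncomputable section

/-- The Euclidean plane. -/
abbrev Plane : Type := EuclideanSpace ℝ (Fin 2)

/-- Rotation by a right angle, counterclockwise. -/
def rotPlane (u : Plane) : Plane := !₂[-u 1, u 0]

/-- The Kepler force field `f(x) = -x / |x|³`. -/
def keplerForce (x : Plane) : Plane := -((‖x‖ ^ 3)⁻¹ • x)

/-- `X` is a (collision-free, global) solution of `x'' = -x / |x|³`, with velocity `V`. -/
structure IsKeplerSolution (X V : ℝ → Plane) : Prop where
  ne_zero : ∀ t, X t ≠ 0
  hasDerivAt_pos : ∀ t, HasDerivAt X (V t) t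
  hasDerivAt_vel : ∀ t, HasDerivAt V (keplerForce (X t)) t

/-- `S` is an ellipse with semimajor axis `a` and semiminor axis `b`
(`c` is the centre and `u` the direction of the major axis). -/
def IsEllipse (S : Set Plane) (a b : ℝ) : Prop :=
  0 < b ∧ b ≤ a ∧ ∃ c u : Plane, ‖u‖ = 1 ∧
    S = {p | (⟪p - c, u⟫ / a) ^ 2 + (⟪p - c, rotPlane u⟫ / b) ^ 2 = 1}

/-- `T` is the (smallest positive) period of `X`. -/
def IsMinimalPeriod (X : ℝ → Plane) (T : ℝ) : Prop :=
  IsLeast {τ : ℝ | 0 < τ ∧ Function.Periodic X τ} T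

/-- The angular momentum `x₁ v₂ - v₁ x₂`. -/
def angularMomentum (x v : Plane) : ℝ := x 0 * v 1 - v 0 * x 1

/-- The Laplace-Runge-Lenz vector `|v|² x - ⟨x, v⟩ v - x / |x|`. -/
def lrlVector (x v : Plane) : Plane := ‖v‖ ^ 2 • x - ⟪x, v⟫ • v - ‖x‖⁻¹ • x

/-- The signed angle in `(-π, π]` from `u` to `w`, i.e. the argument of `conj u * w`. -/
def signedAngle (u w : Plane) : ℝ :=
  Complex.arg ⟨u 0 * w 0 + u 1 * w 1, u 0 * w 1 - u 1 * w 0⟩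

/-! ### The Störmer-Verlet method -/

/-- `(x_{k+1} - 2 x_k + x_{k-1}) / h² = f(x_k)` for all `k ≥ 1`. -/
def IsStormerVerlet (h : ℝ) (x : ℕ → Plane) : Prop :=
  ∀ k : ℕ, (h ^ 2)⁻¹ • (x (k + 2) - (2 : ℝ) • x (k + 1) + x k) = keplerForce (x (k + 1))

/-- The discrete momentum `p_k = (x_{k+1} - x_k) / h - (h / 2) f(x_k)`; on solutions of the
method it equals the central difference `(x_{k+1} - x_{k-1}) / (2 h)` for `k ≥ 1`. -/
def svMomentum (h : ℝ) (x : ℕ → Plane) (k : ℕ) : Plane :=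
  h⁻¹ • (x (k + 1) - x k) - (h / 2) • keplerForce (x k)

/-- The Laplace-Runge-Lenz vector of the numerical solution after `k` steps. -/
def svLrl (h : ℝ) (x : ℕ → Plane) (k : ℕ) : Plane := lrlVector (x k) (svMomentum h x k)

/-- The angle through which the Laplace-Runge-Lenz vector has turned after `n` steps. -/
def svAngle (h : ℝ) (x : ℕ → Plane) (n : ℕ) : ℝ :=
  ∑ k ∈ Finset.range n, signedAngle (svLrl h x k) (svLrl h x (k + 1))

/-- The angle through which the Laplace-Runge-Lenz vector of the numerical solution has turned
at time `T`, interpolated linearly in time between grid points (so it is `svAngle h x N`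
if `T = N h`). -/
def svPrecession (h : ℝ) (x : ℕ → Plane) (T : ℝ) : ℝ :=
  svAngle h x ⌊T / h⌋₊ +
    (T / h - ⌊T / h⌋₊) * (svAngle h x (⌊T / h⌋₊ + 1) - svAngle h x ⌊T / h⌋₊)

/-! ### The modified Lagrangian -/

/-- The modified Lagrangian of second order accuracy of the Störmer-Verlet method. -/
def svModLagrangian (h : ℝ) (x v : Plane) : ℝ :=
  1 / 2 * ‖v‖ ^ 2 + 1 / ‖x‖ +
    h ^ 2 / 24 * (1 / ‖x‖ ^ 4 - 2 * (‖v‖ ^ 2 / ‖x‖ ^ 3) + 6 * (⟪x, v⟫ ^ 2 / ‖x‖ ^ 5))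

/-- `x` is a twice continuously differentiable, collision-free curve on `[0, T]` with velocity `v`
that satisfies the Euler-Lagrange equation `d/dt (∂L/∂v) = ∂L/∂x`. -/
structure IsEulerLagrangeSolution (L : Plane → Plane → ℝ) (T : ℝ) (x v : ℝ → Plane) : Prop where
  ne_zero : ∀ t ∈ Set.Icc 0 T, x t ≠ 0
  hasDeriv : ∀ t ∈ Set.Icc 0 T, HasDerivWithinAt x (v t) (Set.Icc 0 T) t
  contDiffOn_vel : ContDiffOn ℝ 1 v (Set.Icc 0 T)
  eulerLagrange : ∀ t ∈ Set.Icc 0 T,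
    HasDerivWithinAt (fun s => gradient (fun w => L (x s) w) (v s))
      (gradient (fun y => L y (v t)) (x t)) (Set.Icc 0 T) t

/-- `θ` is a continuous angle on `[0, T]` of the Laplace-Runge-Lenz vector along `(x, v)`. -/
def IsLrlAngle (T : ℝ) (x v : ℝ → Plane) (θ : ℝ → ℝ) : Prop :=
  ContinuousOn θ (Set.Icc 0 T) ∧ ∀ t ∈ Set.Icc 0 T,
    lrlVector (x t) (v t) = ‖lrlVector (x t) (v t)‖ • !₂[Real.cos (θ t), Real.sin (θ t)]

end

/-! Project the Laplace-Runge-Lenz vector of a perturbed orbit onto the direction orthogonal to the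
unperturbed vector `m`, which is constant: the projection is `angularMomentum m R`, and dividing it
by `|m|²` gives the angle up to an error of fourth order. A step of the method is a half kick, a
straight drift and a half kick, so the angular momentum `l` is conserved and the projection changes
exactly by `l` times the error of the trapezoidal rule for the dipole potential `⟨m, x⟩ / |x|³`
along the drift. To leading order this is `h³ l / 12` times the second derivative `D` of the
potential in the direction of the velocity. The flow of the modified Lagrangian changes the
projection at the rate `h² l D / 12`, once velocities are replaced by momenta, a replacement that
over a full period has no effect of second order. In both cases the precession is therefore
`h² l / (12 |m|²)` times the integral of `D` over one period, an elementary integral in the polar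
angle. -/

open Filter Asymptotics Set Topology

/-! ### Uniform asymptotics near compact sets -/

section Compact

variable {α : Type*} {l : Filter α}

theorem tendsto_nhdsSet_of_tendsto_sub {E : Type*} [SeminormedAddCommGroup E] {K : Set E}
    {y z : α → E} (hK : IsCompact K) (hy : ∀ᶠ q in l, y q ∈ K)
    (hzy : Tendsto (fun q => z q - y q) l (𝓝 0)) : Tendsto z l (𝓝ˢ K) := by
  intro U hU
  obtain ⟨V, hVo, hKV, hVU⟩ := mem_nhdsSet_iff_exists.1 hU
  obtain ⟨δ, hδ, hδV⟩ := hK.exists_thickening_subset_open hVo hKV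
  rw [mem_map]
  filter_upwards [hy, hzy (Metric.ball_mem_nhds 0 hδ)] with q hyq hq
  refine hVU (hδV (Metric.mem_thickening_iff.2 ⟨y q, hyq, ?_⟩))
  rwa [dist_eq_norm, ← mem_ball_zero_iff]

theorem isBigO_nhdsSet_of_forall {X F G : Type*} [TopologicalSpace X] [Norm F]
    [SeminormedAddCommGroup G] {K : Set X} {f : X → F} {g : X → G} (hK : IsCompact K)
    (h : ∀ y ∈ K, f =O[𝓝 y] g) : f =O[𝓝ˢ K] g := by
  refine hK.induction_on (p := fun s => f =O[𝓝ˢ s] g) (by simp)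
    (fun s t hst ht => ht.mono (nhdsSet_mono hst)) (fun s t hs ht => ?_) fun y hy => ?_
  · rw [nhdsSet_union]
    exact hs.sup ht
  · obtain ⟨C, hC⟩ := (h y hy).bound
    obtain ⟨t, ht, hto, hyt⟩ := mem_nhds_iff.1 hC
    exact ⟨t, mem_nhdsWithin_of_mem_nhds (hto.mem_nhds hyt),
      .of_bound C (mem_of_superset hto.mem_nhdsSet_self ht)⟩

theorem isBigO_comp_sub_comp {E F : Type*} [NormedAddCommGroup E] [NormedSpace ℝ E]
    [NormedAddCommGroup F] [NormedSpace ℝ F] {K : Set E} {y z w : α → E} {g : E → F}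
    (hK : IsCompact K) (hg : ∀ x ∈ K, ContDiffAt ℝ 1 g x) (hy : ∀ᶠ q in l, y q ∈ K)
    (hzy : Tendsto (fun q => z q - y q) l (𝓝 0)) (hwy : Tendsto (fun q => w q - y q) l (𝓝 0)) :
    (fun q => g (z q) - g (w q)) =O[l] fun q => z q - w q := by
  have hdiag : IsCompact ((fun x => (x, x)) '' K) := hK.image (by fun_prop)
  have hlocal : ∀ x ∈ (fun x => (x, x)) '' K,
      (fun x : E × E => g x.1 - g x.2) =O[𝓝 x] fun x => x.1 - x.2 := by
    rintro _ ⟨x, hx, rfl⟩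
    exact ((hg x hx).hasStrictFDerivAt one_ne_zero).isBigO_sub
  exact (isBigO_nhdsSet_of_forall hdiag hlocal).comp_tendsto (k := fun q => (z q, w q))
    (tendsto_nhdsSet_of_tendsto_sub (y := fun q => (y q, y q)) hdiag
      (hy.mono fun q hq => mem_image_of_mem _ hq) (hzy.prodMk_nhds hwy))

theorem isBigO_comp_one {E F : Type*} [SeminormedAddCommGroup E] [SeminormedAddCommGroup F]
    {K : Set E} {y z : α → E} {g : E → F} (hK : IsCompact K) (hg : ∀ x ∈ K, ContinuousAt g x)
    (hy : ∀ᶠ q in l, y q ∈ K) (hzy : Tendsto (fun q => z q - y q) l (𝓝 0)) :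
    (fun q => g (z q)) =O[l] fun _ => (1 : ℝ) :=
  (isBigO_nhdsSet_of_forall hK fun x hx => (hg x hx).isBigO_one ℝ).comp_tendsto
    (tendsto_nhdsSet_of_tendsto_sub hK hy hzy)

end Compact

/-! ### Taylor estimates with parameters -/

section Taylor

variable {F : Type*} [NormedAddCommGroup F] [NormedSpace ℝ F]

theorem isBigO_pow_succ_of_hasDerivAt {P : Type*} {l : Filter P} {e e' : P × ℝ → F} {n : ℕ}
    (hd : ∀ᶠ q in l ×ˢ 𝓝 (0 : ℝ), HasDerivAt (fun s => e (q.1, s)) (e' q) q.2)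
    (h0 : ∀ p, e (p, 0) = 0) (he' : e' =O[l ×ˢ 𝓝 (0 : ℝ)] fun q => q.2 ^ n) :
    e =O[l ×ˢ 𝓝 (0 : ℝ)] fun q => q.2 ^ (n + 1) := by
  obtain ⟨C, hC0, hC⟩ := he'.exists_nonneg
  obtain ⟨A, hA, B, hB, hAB⟩ := eventually_prod_iff.1 (hd.and hC.bound)
  obtain ⟨ε, hε, hεB⟩ := Metric.eventually_nhds_iff.1 hB
  refine .of_bound C (eventually_prod_iff.2 ⟨A, hA, _, Metric.ball_mem_nhds 0 hε,
    fun {p} hp {s} hs => ?_⟩)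
  have hle : ∀ r ∈ uIcc 0 s, |r| ≤ |s| := fun r hr => by
    simpa using abs_sub_left_of_mem_uIcc hr
  have hr : ∀ r ∈ uIcc 0 s, HasDerivAt (fun s => e (p, s)) (e' (p, r)) r ∧
      ‖e' (p, r)‖ ≤ C * ‖r ^ n‖ := fun r hr => hAB hp <| hεB <| by
    rw [Real.dist_0_eq_abs] at hs ⊢
    exact (hle r hr).trans_lt hs
  have hmvt := (convex_uIcc 0 s).norm_image_sub_le_of_norm_hasDerivWithin_le
    (f := fun s => e (p, s)) (C := C * |s| ^ n) (fun r h => (hr r h).1.hasDerivWithinAt)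
    (fun r h => (hr r h).2.trans ?_) left_mem_uIcc right_mem_uIcc
  · simpa [h0, pow_succ, mul_assoc] using hmvt
  · rw [norm_pow, Real.norm_eq_abs]
    exact mul_le_mul_of_nonneg_left (pow_le_pow_left₀ (abs_nonneg r) (hle r h) n) hC0

variable {g g' g'' : ℝ → F} (t₀ : ℝ)

theorem tendsto_add_nhds_zero : Tendsto (fun q : ℝ × ℝ => q.1 + q.2) (𝓝 t₀ ×ˢ 𝓝 0) (𝓝 t₀) := by
  rw [← nhds_prod_eq]
  exact Continuous.tendsto' (by fun_prop) _ _ (add_zero t₀)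

theorem isBigO_sub_of_hasDerivAt (hg : ∀ t, HasDerivAt g (g' t) t) (hg' : Continuous g') :
    (fun q : ℝ × ℝ => g (q.1 + q.2) - g q.1) =O[𝓝 t₀ ×ˢ 𝓝 0] fun q => q.2 := by
  have h := isBigO_pow_succ_of_hasDerivAt (l := 𝓝 t₀) (n := 0)
    (e := fun q : ℝ × ℝ => g (q.1 + q.2) - g q.1) (e' := fun q => g' (q.1 + q.2))
    (.of_forall fun q => ((hg _).comp_const_add q.1 q.2).sub_const (g q.1)) (by simp) ?_
  · simpa using h
  · simp only [pow_zero]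
    exact (hg'.continuousAt.isBigO_one ℝ).comp_tendsto (tendsto_add_nhds_zero t₀)

theorem isBigO_taylor_two (hg : ∀ t, HasDerivAt g (g' t) t) (hg' : ContDiff ℝ 1 g') :
    (fun q : ℝ × ℝ => g (q.1 + q.2) - g q.1 - q.2 • g' q.1) =O[𝓝 t₀ ×ˢ 𝓝 0]
      fun q => q.2 ^ 2 := by
  refine isBigO_pow_succ_of_hasDerivAt (n := 1)
    (e' := fun q : ℝ × ℝ => g' (q.1 + q.2) - g' q.1) (.of_forall fun q => ?_) (by simp) ?_
  · simpa using (((hg _).comp_const_add q.1 q.2).sub_const (g q.1)).fun_sub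
      ((hasDerivAt_id q.2).smul_const (g' q.1))
  · simpa using isBigO_sub_of_hasDerivAt t₀
      (fun t => (hg'.differentiable one_ne_zero t).hasDerivAt) (hg'.continuous_deriv le_rfl)

theorem isBigO_taylor_three (hg : ∀ t, HasDerivAt g (g' t) t)
    (hg' : ∀ t, HasDerivAt g' (g'' t) t) (hg'' : ContDiff ℝ 1 g'') :
    (fun q : ℝ × ℝ => g (q.1 + q.2) - g q.1 - q.2 • g' q.1 - (q.2 ^ 2 / 2) • g'' q.1)
      =O[𝓝 t₀ ×ˢ 𝓝 0] fun q => q.2 ^ 3 := by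
  refine isBigO_pow_succ_of_hasDerivAt (.of_forall fun q => ?_) (by simp)
    (isBigO_taylor_two t₀ hg' hg'')
  have hsq : HasDerivAt (fun s : ℝ => s ^ 2 / 2) q.2 q.2 := by
    simpa using (hasDerivAt_pow 2 q.2).div_const 2
  simpa using ((((hg _).comp_const_add q.1 q.2).sub_const (g q.1)).fun_sub
    ((hasDerivAt_id q.2).smul_const (g' q.1))).fun_sub (hsq.smul_const (g'' q.1))

theorem isBigO_trapezoid (hg : ∀ t, HasDerivAt g (g' t) t) (hg' : ContDiff ℝ 2 g') :
    (fun q : ℝ × ℝ => g (q.1 + q.2) - g q.1 - (q.2 / 2) • (g' q.1 + g' (q.1 + q.2)))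
      =O[𝓝 t₀ ×ˢ 𝓝 0] fun q => q.2 ^ 3 := by
  have hderiv (t : ℝ) : HasDerivAt g' (deriv g' t) t :=
    (hg'.differentiable two_ne_zero t).hasDerivAt
  have hderiv' : ContDiff ℝ 1 (deriv g') := hg'.deriv'
  have hsmul := (isBigO_refl (fun q : ℝ × ℝ => q.2 / 2) (𝓝 t₀ ×ˢ 𝓝 0)).smul
    (isBigO_taylor_two t₀ hderiv hderiv')
  refine ((isBigO_taylor_three t₀ hg hderiv hderiv').sub (hsmul.trans ?_)).congr_left fun q => ?_
  · exact .of_bound (1 / 2) (.of_forall fun q => le_of_eq <| by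
      simp only [smul_eq_mul, norm_mul, norm_div, norm_pow, RCLike.norm_ofNat]
      ring)
  · module

theorem isBigO_midpoint (hg : ∀ t, HasDerivAt g (g' t) t) (hg' : ContDiff ℝ 2 g') :
    (fun q : ℝ × ℝ => g (q.1 + q.2) - g q.1 - q.2 • g' (q.1 + q.2 / 2))
      =O[𝓝 t₀ ×ˢ 𝓝 0] fun q => q.2 ^ 3 := by
  have hderiv (t : ℝ) : HasDerivAt g' (deriv g' t) t :=
    (hg'.differentiable two_ne_zero t).hasDerivAt
  have hderiv' : ContDiff ℝ 1 (deriv g') := hg'.deriv'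
  have hhalf (c : ℝ) : (fun q : ℝ × ℝ => g (q.1 + q.2 / 2 + c * q.2) - g (q.1 + q.2 / 2) -
      (c * q.2) • g' (q.1 + q.2 / 2) - ((c * q.2) ^ 2 / 2) • deriv g' (q.1 + q.2 / 2))
      =O[𝓝 t₀ ×ˢ 𝓝 0] fun q => q.2 ^ 3 := by
    refine ((isBigO_taylor_three t₀ hg hderiv hderiv').comp_tendsto
      (k := fun q : ℝ × ℝ => (q.1 + q.2 / 2, c * q.2)) ?_).trans ?_
    · simp only [← nhds_prod_eq]
      exact Continuous.tendsto' (by fun_prop) _ _ (by simp)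
    · simpa [Function.comp_def, mul_pow] using
        (isBigO_refl (fun q : ℝ × ℝ => q.2 ^ 3) _).const_mul_left (c ^ 3)
  refine ((hhalf (1 / 2)).sub (hhalf (-1 / 2))).congr_left fun q => ?_
  rw [show q.1 + q.2 / 2 + 1 / 2 * q.2 = q.1 + q.2 by ring,
    show q.1 + q.2 / 2 + -1 / 2 * q.2 = q.1 by ring]
  module

end Taylor

/-! ### One-step methods -/

section OneStep

variable {ι : Type*} {l : Filter ι} {h : ι → ℝ} {T : ℝ} {p : ℕ}

/-- For the step sizes `h i`, the filter of pairs `(i, k)` with `i` tending to infinity along `l`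
and grid time `k h i` at most `T`: an estimate along it is an estimate as `i` tends to infinity,
uniformly in the grid points up to time `T`. -/
def gridFilter (l : Filter ι) (h : ι → ℝ) (T : ℝ) : Filter (ι × ℕ) :=
  comap Prod.fst l ⊓ 𝓟 {q | q.2 * h q.1 ≤ T}

theorem eventually_gridFilter {P : ι × ℕ → Prop} :
    (∀ᶠ q in gridFilter l h T, P q) ↔ ∀ᶠ i in l, ∀ k : ℕ, k * h i ≤ T → P (i, k) := by
  simp only [gridFilter, eventually_inf_principal, eventually_comap, Prod.forall, mem_ofPred_eq]
  exact eventually_congr (.of_forall fun i => ⟨fun H k => H i k rfl, fun H _ k hk => hk ▸ H k⟩)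

theorem tendsto_fst_gridFilter : Tendsto Prod.fst (gridFilter l h T) l :=
  tendsto_comap.mono_left inf_le_left

theorem tendsto_gridFilter {n : ι → ℕ} (hn : ∀ᶠ i in l, n i * h i ≤ T) :
    Tendsto (fun i => (i, n i)) l (gridFilter l h T) :=
  tendsto_inf.2 ⟨tendsto_comap_iff.2 tendsto_id, tendsto_principal.2 hn⟩

theorem eventually_gridFilter_mem_Icc (hh : ∀ᶠ i in l, 0 < h i) :
    ∀ᶠ q in gridFilter l h T, q.2 * h q.1 ∈ Icc 0 T :=
  eventually_gridFilter.2 (hh.mono fun _ hi k hk => ⟨by positivity, hk⟩)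

theorem isBigO_gridFilter_of_forall {F : Type*} [Norm F] {f : ℝ × ℝ → F} {n : ℕ}
    (hh : Tendsto h l (𝓝[>] 0))
    (hf : ∀ t ∈ Icc 0 T, f =O[𝓝 t ×ˢ 𝓝 0] fun q => q.2 ^ n) :
    (fun q => f (q.2 * h q.1, h q.1)) =O[gridFilter l h T] fun q => h q.1 ^ n := by
  have hK : IsCompact (Icc 0 T ×ˢ {(0 : ℝ)}) := isCompact_Icc.prod isCompact_singleton
  refine (isBigO_nhdsSet_of_forall (g := fun q : ℝ × ℝ => q.2 ^ n) hK ?_).comp_tendsto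
    (k := fun q : ι × ℕ => (q.2 * h q.1, h q.1))
    (tendsto_nhdsSet_of_tendsto_sub (E := ℝ × ℝ)
      (y := fun q => (q.2 * h q.1, 0)) hK ?_ ?_)
  · rintro ⟨t, s⟩ ⟨ht, rfl⟩
    simpa only [nhds_prod_eq] using hf t ht
  · filter_upwards [eventually_gridFilter_mem_Icc (hh.eventually self_mem_nhdsWithin)] with q hq
    exact ⟨hq, rfl⟩
  · simpa [Prod.zero_eq_mk] using (tendsto_const_nhds (x := (0 : ℝ))).prodMk_nhds
      ((hh.mono_right nhdsWithin_le_nhds).comp tendsto_fst_gridFilter)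

theorem isBigO_gridFilter_sub_zero {F : Type*} [SeminormedAddCommGroup F] {r : ι → ℕ → F}
    (hh : ∀ᶠ i in l, 0 < h i)
    (hr : (fun q => r q.1 (q.2 + 1) - r q.1 q.2) =O[gridFilter l h T] fun q => h q.1 ^ (p + 1)) :
    (fun q => r q.1 q.2 - r q.1 0) =O[gridFilter l h T] fun q => h q.1 ^ p := by
  obtain ⟨C, hC0, hC⟩ := hr.exists_nonneg
  refine .of_bound (C * T) (eventually_gridFilter.2 ?_)
  filter_upwards [hh, eventually_gridFilter.1 hC.bound] with i hi hstep n hn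
  have hsum : ‖r i n - r i 0‖ ≤ ∑ _k ∈ Finset.range n, C * h i ^ (p + 1) := by
    rw [← Finset.sum_range_sub]
    refine norm_sum_le_of_le _ fun k hk => (hstep k (le_trans ?_ hn)).trans_eq ?_
    · gcongr
      exact (Finset.mem_range.1 hk).le
    · rw [norm_pow, Real.norm_of_nonneg hi.le]
  calc ‖r i n - r i 0‖ ≤ C * h i ^ p * (n * h i) := by
        refine hsum.trans_eq ?_
        rw [Finset.sum_const, Finset.card_range, nsmul_eq_mul]
        ring
    _ ≤ C * h i ^ p * T := by gcongr
    _ = C * T * ‖h i ^ p‖ := by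
        rw [norm_pow, Real.norm_of_nonneg hi.le]
        ring

theorem le_exp_mul_of_forall_le_one_add_mul {e : ℕ → ℝ} {s M d δ : ℝ} {n : ℕ} (he : 0 ≤ e 0)
    (hs : 0 ≤ s) (hM : 0 ≤ M) (hd : 0 ≤ d) (hsmall : Real.exp (M * T) * (e 0 + T * d) < δ)
    (hstep : ∀ k : ℕ, (k + 1 : ℕ) * s ≤ T → e k < δ → e (k + 1) ≤ (1 + M * s) * e k + s * d)
    (hn : n * s ≤ T) : e n ≤ Real.exp (M * T) * (e 0 + T * d) := by
  have hexp (n : ℕ) (hn : n * s ≤ T) :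
      (1 + M * s) ^ n * (e 0 + n * s * d) ≤ Real.exp (M * T) * (e 0 + T * d) := by
    have hpow : (1 + M * s) ^ n ≤ Real.exp (M * T) :=
      calc (1 + M * s) ^ n ≤ Real.exp (M * s) ^ n := by
            gcongr
            linarith [Real.add_one_le_exp (M * s)]
        _ = Real.exp (M * (n * s)) := by rw [← Real.exp_nat_mul]; ring_nf
        _ ≤ Real.exp (M * T) := by gcongr
    gcongr
  refine le_trans ?_ (hexp n hn)
  induction n with
  | zero => simp
  | succ n ih =>
    have hn' : n * s ≤ T := le_trans (by gcongr; exact n.le_succ) hn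
    have hone : 1 ≤ (1 + M * s) ^ (n + 1) := one_le_pow₀ (by linarith [mul_nonneg hM hs])
    calc e (n + 1) ≤ (1 + M * s) * e n + s * d :=
          hstep n hn (((ih hn').trans (hexp n hn')).trans_lt hsmall)
      _ ≤ (1 + M * s) * ((1 + M * s) ^ n * (e 0 + n * s * d)) + (1 + M * s) ^ (n + 1) * (s * d) :=
          add_le_add (by gcongr; exact ih hn') (le_mul_of_one_le_left (by positivity) hone)
      _ = (1 + M * s) ^ (n + 1) * (e 0 + (n + 1 : ℕ) * s * d) := by push_cast; ring

variable {E : Type*} [NormedAddCommGroup E] [NormedSpace ℝ E] {Y : ℝ → E} {Ψ : ℝ × E → E}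

theorem exists_norm_sub_le_near_orbit (hY : ContinuousOn Y (Icc 0 T))
    (hΨ : ∀ t ∈ Icc 0 T, ContDiffAt ℝ 1 Ψ (0, Y t)) :
    ∃ M ≥ 0, ∃ δ > 0, ∀ t ∈ Icc 0 T, ∀ s z, |s| < δ → ‖z - Y t‖ < δ →
      ‖Ψ (s, z) - Ψ (s, Y t)‖ ≤ M * ‖z - Y t‖ := by
  set φ : ℝ × ℝ × E → ℝ × E := fun q => (q.2.1, q.2.2 - Y q.1)
  have hK : IsCompact ({(0 : ℝ)} ×ˢ (Y '' Icc 0 T)) :=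
    isCompact_singleton.prod (isCompact_Icc.image_of_continuousOn hY)
  have hφ : Tendsto φ (comap φ (𝓝 0) ⊓ 𝓟 {q | q.1 ∈ Icc 0 T}) (𝓝 0) :=
    tendsto_comap.mono_left inf_le_left
  have hfst : Tendsto (fun q : ℝ × ℝ × E => q.2.1) (comap φ (𝓝 0) ⊓ 𝓟 {q | q.1 ∈ Icc 0 T}) (𝓝 0) :=
    hφ.fst_nhds
  have hlip := isBigO_comp_sub_comp (g := Ψ)
    (l := comap φ (𝓝 0) ⊓ 𝓟 {q | q.1 ∈ Icc 0 T}) (y := fun q : ℝ × ℝ × E => ((0 : ℝ), Y q.1))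
    (z := fun q => q.2) (w := fun q => (q.2.1, Y q.1)) hK
    (by rintro ⟨s, _⟩ ⟨rfl, t, ht, rfl⟩; exact hΨ t ht)
    (eventually_inf_principal.2 (.of_forall fun q hq => ⟨rfl, mem_image_of_mem Y hq⟩))
    (hφ.congr fun q => by simp [φ, Prod.ext_iff])
    (by simpa [Prod.zero_eq_mk] using hfst.prodMk_nhds (tendsto_const_nhds (x := (0 : E))))
  obtain ⟨M, hM0, hM⟩ := hlip.exists_nonneg
  obtain ⟨U, hU, hUM⟩ := eventually_comap.1 (eventually_inf_principal.1 hM.bound) |>.exists_mem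
  obtain ⟨δ, hδ, hδU⟩ := Metric.mem_nhds_iff.1 hU
  refine ⟨M, hM0, δ, hδ, fun t ht s z hs hz => ?_⟩
  have hmem : φ (t, s, z) ∈ U := hδU (by simpa [φ, Prod.norm_def] using ⟨hs, hz⟩)
  simpa using hUM _ hmem (t, s, z) rfl ht

theorem isBigO_oneStep_sub {z : ι → ℕ → E} (hY : ContinuousOn Y (Icc 0 T))
    (hΨ : ∀ t ∈ Icc 0 T, ContDiffAt ℝ 1 Ψ (0, Y t)) (hp : p ≠ 0)
    (hloc : ∀ t ∈ Icc 0 T, (fun q : ℝ × ℝ => Y (q.1 + q.2) - (Y q.1 + q.2 • Ψ (q.2, Y q.1)))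
      =O[𝓝 t ×ˢ 𝓝 0] fun q => q.2 ^ (p + 1))
    (hh : Tendsto h l (𝓝[>] 0)) (hz₀ : (fun i => z i 0 - Y 0) =O[l] fun i => h i ^ p)
    (hz : ∀ᶠ i in l, ∀ k, z i (k + 1) = z i k + h i • Ψ (h i, z i k)) :
    (fun q => z q.1 q.2 - Y (q.2 * h q.1)) =O[gridFilter l h T] fun q => h q.1 ^ p := by
  obtain ⟨M, hM0, δ, hδ, hlip⟩ := exists_norm_sub_le_near_orbit hY hΨ
  obtain ⟨C, hC0, hC⟩ := (isBigO_gridFilter_of_forall hh hloc).exists_nonneg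
  obtain ⟨D, _, hD⟩ := hz₀.exists_nonneg
  have hh0 : Tendsto h l (𝓝 0) := hh.mono_right nhdsWithin_le_nhds
  have hsmall : ∀ᶠ i in l, Real.exp (M * T) * (D + T * C) * h i ^ p < δ :=
    ((hh0.pow p).const_mul _).eventually_lt_const (by simpa [hp] using hδ)
  refine .of_bound (Real.exp (M * T) * (D + T * C)) (eventually_gridFilter.2 ?_)
  filter_upwards [hh.eventually self_mem_nhdsWithin, hh0 (Metric.ball_mem_nhds 0 hδ), hsmall, hz,
    eventually_gridFilter.1 hC.bound, hD.bound] with i hi hiδ hiB hzi hCi hDi n hn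
  rw [norm_pow, Real.norm_of_nonneg (le_of_lt hi)] at hDi ⊢
  have hstep (k : ℕ) (hk : (k + 1 : ℕ) * h i ≤ T) (hkδ : ‖z i k - Y (k * h i)‖ < δ) :
      ‖z i (k + 1) - Y ((k + 1 : ℕ) * h i)‖ ≤
        (1 + M * h i) * ‖z i k - Y (k * h i)‖ + h i * (C * h i ^ p) := by
    have hkT : k * h i ≤ T := le_trans (by gcongr; exact k.le_succ) hk
    have hsplit : z i (k + 1) - Y ((k + 1 : ℕ) * h i) = (z i k - Y (k * h i)) +
        h i • (Ψ (h i, z i k) - Ψ (h i, Y (k * h i))) -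
          (Y (k * h i + h i) - (Y (k * h i) + h i • Ψ (h i, Y (k * h i)))) := by
      rw [hzi, show ((k + 1 : ℕ) : ℝ) * h i = k * h i + h i by push_cast; ring]
      module
    have hΨk := hlip _ ⟨by positivity, hkT⟩ (h i) (z i k) (by simpa using hiδ) hkδ
    have hCk := hCi k hkT
    simp only [norm_pow, Real.norm_of_nonneg (le_of_lt hi)] at hCk
    calc _ ≤ ‖z i k - Y (k * h i)‖ + h i * (M * ‖z i k - Y (k * h i)‖) + C * h i ^ (p + 1) := by
          rw [hsplit]
          refine norm_sub_le_of_le (norm_add_le_of_le le_rfl ?_) hCk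
          rw [norm_smul, Real.norm_of_nonneg (le_of_lt hi)]
          gcongr
      _ = _ := by ring
  have hDT : Real.exp (M * T) * (‖z i 0 - Y ((0 : ℕ) * h i)‖ + T * (C * h i ^ p)) ≤
      Real.exp (M * T) * (D + T * C) * h i ^ p := by
    rw [mul_assoc, add_mul, mul_assoc T]
    gcongr
    simpa using hDi
  exact (le_exp_mul_of_forall_le_one_add_mul (e := fun k => ‖z i k - Y (k * h i)‖)
    (norm_nonneg _) (le_of_lt hi) hM0 (by positivity) (hDT.trans_lt hiB) hstep hn).trans hDT

end OneStep

/-! ### The plane -/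

theorem inner_plane (x y : Plane) : ⟪x, y⟫ = x 0 * y 0 + x 1 * y 1 := by
  simp [PiLp.inner_apply, Fin.sum_univ_two, mul_comm]

theorem norm_sq_plane (x : Plane) : ‖x‖ ^ 2 = x 0 ^ 2 + x 1 ^ 2 := by
  rw [EuclideanSpace.real_norm_sq_eq, Fin.sum_univ_two]

theorem inner_sq_add_angularMomentum_sq (x y : Plane) :
    ⟪x, y⟫ ^ 2 + angularMomentum x y ^ 2 = ‖x‖ ^ 2 * ‖y‖ ^ 2 := by
  rw [inner_plane, norm_sq_plane, norm_sq_plane, angularMomentum]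
  ring

theorem angularMomentum_add_right (x y z : Plane) :
    angularMomentum x (y + z) = angularMomentum x y + angularMomentum x z := by
  simp only [angularMomentum, PiLp.add_apply]
  ring

theorem angularMomentum_sub_right (x y z : Plane) :
    angularMomentum x (y - z) = angularMomentum x y - angularMomentum x z := by
  simp only [angularMomentum, PiLp.sub_apply]
  ring

theorem angularMomentum_smul_right (x y : Plane) (r : ℝ) :
    angularMomentum x (r • y) = r * angularMomentum x y := by
  simp only [angularMomentum, PiLp.smul_apply, smul_eq_mul]
  ring

theorem angularMomentum_add_left (x y z : Plane) :
    angularMomentum (x + y) z = angularMomentum x z + angularMomentum y z := by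
  simp only [angularMomentum, PiLp.add_apply]
  ring

theorem angularMomentum_smul_left (x y : Plane) (r : ℝ) :
    angularMomentum (r • x) y = r * angularMomentum x y := by
  simp only [angularMomentum, PiLp.smul_apply, smul_eq_mul]
  ring

theorem angularMomentum_self (x : Plane) : angularMomentum x x = 0 := by
  simp only [angularMomentum]
  ring

/-! ### Angles in the plane -/

/-- The standard identification of the plane with `ℂ`; it turns signed angles into arguments. -/
noncomputable def planeToComplex : Plane ≃ₗᵢ[ℝ] ℂ := Complex.orthonormalBasisOneI.repr.symm

theorem planeToComplex_apply (u : Plane) : planeToComplex u = ⟨u 0, u 1⟩ := by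
  rw [planeToComplex, Complex.orthonormalBasisOneI_repr_symm_apply]
  apply Complex.ext <;> simp

theorem signedAngle_eq_arg (u w : Plane) :
    signedAngle u w = Complex.arg (starRingEnd ℂ (planeToComplex u) * planeToComplex w) := by
  rw [signedAngle, planeToComplex_apply, planeToComplex_apply]
  congr 1
  apply Complex.ext
  · simp
  · simp only [Complex.mul_im, Complex.conj_re, Complex.conj_im]
    ring

theorem conj_mul_self_planeToComplex (m : Plane) :
    starRingEnd ℂ (planeToComplex m) * planeToComplex m = ((‖m‖ ^ 2 : ℝ) : ℂ) := by
  rw [mul_comm, Complex.mul_conj, Complex.normSq_eq_norm_sq, planeToComplex.norm_map]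

theorem conj_mul_planeToComplex_re_pos {m u : Plane} (hu : ‖u - m‖ < ‖m‖) :
    0 < (starRingEnd ℂ (planeToComplex m) * planeToComplex u).re := by
  have hsplit : starRingEnd ℂ (planeToComplex m) * planeToComplex u =
      ((‖m‖ ^ 2 : ℝ) : ℂ) + starRingEnd ℂ (planeToComplex m) * planeToComplex (u - m) := by
    rw [← conj_mul_self_planeToComplex, map_sub]
    ring
  have hre := (abs_le.1 (Complex.abs_re_le_norm
    (starRingEnd ℂ (planeToComplex m) * planeToComplex (u - m)))).1
  rw [norm_mul, Complex.norm_conj, planeToComplex.norm_map, planeToComplex.norm_map] at hre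
  rw [hsplit, Complex.add_re, Complex.ofReal_re]
  nlinarith [norm_nonneg (u - m)]

theorem ne_zero_of_norm_sub_lt {E : Type*} [SeminormedAddCommGroup E] {m u : E}
    (hu : ‖u - m‖ < ‖m‖) : u ≠ 0 := by
  rintro rfl
  simp at hu

theorem coe_signedAngle {u w : Plane} (hu : u ≠ 0) (hw : w ≠ 0) :
    (signedAngle u w : Real.Angle) =
      (planeToComplex w).arg - ((planeToComplex u).arg : Real.Angle) := by
  have hu' : planeToComplex u ≠ 0 := by simpa using hu
  have hw' : planeToComplex w ≠ 0 := by simpa using hw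
  rw [signedAngle_eq_arg, Complex.arg_mul_coe_angle ((map_ne_zero _).2 hu') hw',
    Complex.arg_conj_coe_angle]
  abel

theorem abs_signedAngle_lt {m u : Plane} (hu : ‖u - m‖ < ‖m‖) :
    |signedAngle m u| < Real.pi / 2 := by
  rw [signedAngle_eq_arg]
  exact Complex.abs_arg_lt_pi_div_two_iff.2 (Or.inl (conj_mul_planeToComplex_re_pos hu))

theorem signedAngle_eq_sub {m u w : Plane} (hu : ‖u - m‖ < ‖m‖) (hw : ‖w - m‖ < ‖m‖) :
    signedAngle u w = signedAngle m w - signedAngle m u := by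
  have hm0 : m ≠ 0 := norm_pos_iff.1 ((norm_nonneg _).trans_lt hu)
  have hu0 := ne_zero_of_norm_sub_lt hu
  have hw0 := ne_zero_of_norm_sub_lt hw
  have hcoe : (signedAngle u w : Real.Angle) = (signedAngle m w - signedAngle m u : ℝ) := by
    rw [Real.Angle.coe_sub, coe_signedAngle hu0 hw0, coe_signedAngle hm0 hw0,
      coe_signedAngle hm0 hu0]
    abel
  have hau := abs_lt.1 (abs_signedAngle_lt hu)
  have haw := abs_lt.1 (abs_signedAngle_lt hw)
  rw [← Real.Angle.toReal_coe_eq_self_iff.2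
    (⟨by linarith, by linarith⟩ : signedAngle m w - signedAngle m u ∈ Ioc (-Real.pi) Real.pi),
    ← hcoe, signedAngle, Complex.arg_coe_angle_toReal_eq_arg]

theorem continuousAt_signedAngle {m u : Plane} (hu : ‖u - m‖ < ‖m‖) :
    ContinuousAt (signedAngle m) u := by
  rw [funext (signedAngle_eq_arg m)]
  exact (Complex.continuousAt_arg (Or.inl (conj_mul_planeToComplex_re_pos hu))).comp
    (f := fun u => starRingEnd ℂ (planeToComplex m) * planeToComplex u)
    (continuous_const.mul planeToComplex.continuous).continuousAt

theorem abs_signedAngle_sub_le {m u : Plane} (hm : m ≠ 0) (hu : ‖u - m‖ ≤ ‖m‖ / 2) :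
    |signedAngle m u - angularMomentum m u / ‖m‖ ^ 2| ≤ (‖u - m‖ / ‖m‖) ^ 2 := by
  have h0 : 0 < ‖m‖ := norm_pos_iff.2 hm
  have hm' : planeToComplex m ≠ 0 := by simpa using hm
  set ζ : ℂ := planeToComplex (u - m) / planeToComplex m with hζ
  have hfactor : starRingEnd ℂ (planeToComplex m) * planeToComplex u =
      ((‖m‖ ^ 2 : ℝ) : ℂ) * (1 + ζ) := by
    rw [← conj_mul_self_planeToComplex, hζ, map_sub]
    field_simp
    ring
  have hζnorm : ‖ζ‖ = ‖u - m‖ / ‖m‖ := by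
    rw [hζ, norm_div, planeToComplex.norm_map, planeToComplex.norm_map]
  have hζhalf : ‖ζ‖ ≤ 1 / 2 := by
    rw [hζnorm, div_le_iff₀ h0]
    linarith
  have hζim : ζ.im = angularMomentum m u / ‖m‖ ^ 2 := by
    rw [hζ, Complex.div_im, Complex.normSq_eq_norm_sq, planeToComplex.norm_map,
      planeToComplex_apply, planeToComplex_apply, angularMomentum]
    simp only [PiLp.sub_apply]
    ring
  have hinv : (1 - ‖ζ‖)⁻¹ ≤ 2 := by
    rw [inv_le_comm₀ (by linarith) two_pos]
    linarith
  rw [signedAngle_eq_arg, hfactor, Complex.arg_real_mul _ (by positivity), ← Complex.log_im,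
    ← hζim, ← Complex.sub_im, ← hζnorm]
  calc _ ≤ ‖Complex.log (1 + ζ) - ζ‖ := Complex.abs_im_le_norm _
    _ ≤ ‖ζ‖ ^ 2 * (1 - ‖ζ‖)⁻¹ / 2 := Complex.norm_log_one_add_sub_self_le (by linarith)
    _ ≤ ‖ζ‖ ^ 2 := by nlinarith [sq_nonneg ‖ζ‖]

theorem isBigO_signedAngle_sub {α : Type*} {l : Filter α} {R : α → Plane} {ε : α → ℝ} {m : Plane}
    (hm : m ≠ 0) (hR : (fun q => R q - m) =O[l] ε) (hε : Tendsto ε l (𝓝 0)) :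
    (fun q => signedAngle m (R q) - angularMomentum m (R q) / ‖m‖ ^ 2) =O[l]
      fun q => ε q ^ 2 := by
  refine IsBigO.trans (.of_bound (‖m‖⁻¹ ^ 2) ?_) (hR.norm_left.pow 2)
  have hlim : Tendsto (fun q => ‖R q - m‖) l (𝓝 0) := by simpa using (hR.trans_tendsto hε).norm
  filter_upwards [hlim.eventually_le_const (half_pos (norm_pos_iff.2 hm))] with q hq
  refine (abs_signedAngle_sub_le hm hq).trans_eq ?_
  rw [norm_pow, norm_norm, div_pow, inv_pow, div_eq_inv_mul]

theorem eq_of_continuousOn_of_coe_angle_eq {g : ℝ → ℝ} {s : Set ℝ} {c : Real.Angle}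
    (hs : IsPreconnected s) (hg : ContinuousOn g s) (hc : ∀ t ∈ s, (g t : Real.Angle) = c)
    {a b : ℝ} (ha : a ∈ s) (hb : b ∈ s) : g a = g b := by
  have hmaps : MapsTo (fun t => g t - g b) s (AddSubgroup.zmultiples (2 * Real.pi)) := by
    intro t ht
    have hzero : ((g t - g b : ℝ) : Real.Angle) = 0 := by
      rw [Real.Angle.coe_sub, hc t ht, hc b hb, sub_self]
    exact AddSubgroup.mem_zmultiples_iff.2 (Real.Angle.coe_eq_zero_iff.1 hzero)
  have hdisc : IsDiscrete (AddSubgroup.zmultiples (2 * Real.pi) : Set ℝ) :=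
    ⟨inferInstanceAs (DiscreteTopology (AddSubgroup.zmultiples (2 * Real.pi)))⟩
  simpa [sub_eq_zero] using hs.constant_of_mapsTo hdisc (hg.sub continuousOn_const) hmaps ha hb

theorem coe_angle_eq_arg {u : Plane} (hu : u ≠ 0) {φ : ℝ}
    (huφ : u = ‖u‖ • !₂[Real.cos φ, Real.sin φ]) :
    (φ : Real.Angle) = (planeToComplex u).arg := by
  have hpolar : planeToComplex u = ((‖u‖ : ℝ) : ℂ) *
      ((Real.cos φ : ℝ) + (Real.sin φ : ℝ) * Complex.I) := by
    conv_lhs => rw [huφ, map_smul, planeToComplex_apply, Complex.real_smul]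
    congr 1
    apply Complex.ext <;> simp [-Complex.ofReal_cos, -Complex.ofReal_sin]
  rw [hpolar]
  exact (Complex.arg_mul_cos_add_sin_mul_I_coe_angle (norm_pos_iff.2 hu) φ).symm

theorem continuous_angle_sub_eq {R : ℝ → Plane} {θ : ℝ → ℝ} {m : Plane} {s : Set ℝ}
    (hs : IsPreconnected s) (hR : ContinuousOn R s) (hθ : ContinuousOn θ s)
    (hnear : ∀ t ∈ s, ‖R t - m‖ < ‖m‖)
    (hRθ : ∀ t ∈ s, R t = ‖R t‖ • !₂[Real.cos (θ t), Real.sin (θ t)]) {a b : ℝ} (ha : a ∈ s)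
    (hb : b ∈ s) : θ b - θ a = signedAngle m (R b) - signedAngle m (R a) := by
  have hm : m ≠ 0 := norm_pos_iff.1 ((norm_nonneg _).trans_lt (hnear a ha))
  have hcont : ContinuousOn (fun t => θ t - signedAngle m (R t)) s := hθ.sub fun t ht =>
    (continuousAt_signedAngle (hnear t ht)).comp_continuousWithinAt (hR t ht)
  have hcoe : ∀ t ∈ s, ((θ t - signedAngle m (R t) : ℝ) : Real.Angle) = (planeToComplex m).arg := by
    intro t ht
    have hRt := ne_zero_of_norm_sub_lt (hnear t ht)
    rw [Real.Angle.coe_sub, coe_signedAngle hm hRt, coe_angle_eq_arg hRt (hRθ t ht)]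
    abel
  linarith [eq_of_continuousOn_of_coe_angle_eq hs hcont hcoe ha hb]

/-! ### Derivatives along curves -/

section Dipole

variable {E : Type*} [NormedAddCommGroup E] [InnerProductSpace ℝ E] {x v : ℝ → E} {x' v' : E}
  {s : Set ℝ} {t : ℝ}

theorem hasDerivWithinAt_inner_left_const (hx : HasDerivWithinAt x x' s t) (m : E) :
    HasDerivWithinAt (fun t => ⟪m, x t⟫) ⟪m, x'⟫ s t := by
  simpa using (hasDerivWithinAt_const t s m).inner ℝ hx

theorem hasDerivWithinAt_norm (hx : HasDerivWithinAt x x' s t) (h0 : x t ≠ 0) :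
    HasDerivWithinAt (fun t => ‖x t‖) (⟪x t, x'⟫ / ‖x t‖) s t := by
  have hsqrt := hx.norm_sq.sqrt (pow_ne_zero 2 (norm_ne_zero_iff.2 h0))
  simp only [Real.sqrt_sq (norm_nonneg _)] at hsqrt
  convert hsqrt using 1
  field_simp

/-- The derivative `Du(x)[v]` of the dipole potential `u(x) = ⟪m, x⟫ / |x|³`. -/
noncomputable def dipoleDeriv (m x v : E) : ℝ :=
  ⟪m, v⟫ / ‖x‖ ^ 3 - 3 * (⟪x, v⟫ * ⟪m, x⟫ / ‖x‖ ^ 5)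

/-- The quadratic form `D²u(x)[v, v]` of the dipole potential `u(x) = ⟪m, x⟫ / |x|³`. -/
noncomputable def dipoleHessian (m x v : E) : ℝ :=
  -6 * (⟪x, v⟫ * ⟪m, v⟫ / ‖x‖ ^ 5) - 3 * (‖v‖ ^ 2 * ⟪m, x⟫ / ‖x‖ ^ 5) +
    15 * (⟪x, v⟫ ^ 2 * ⟪m, x⟫ / ‖x‖ ^ 7)

theorem hasDerivWithinAt_dipole (hx : HasDerivWithinAt x x' s t) (h0 : x t ≠ 0) (m : E) :
    HasDerivWithinAt (fun t => ⟪m, x t⟫ / ‖x t‖ ^ 3) (dipoleDeriv m (x t) x') s t := by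
  have hn : ‖x t‖ ≠ 0 := norm_ne_zero_iff.2 h0
  refine ((hasDerivWithinAt_inner_left_const hx m).fun_div
    ((hasDerivWithinAt_norm hx h0).fun_pow 3) (pow_ne_zero 3 hn)).congr_deriv ?_
  simp only [dipoleDeriv]
  field_simp
  push_cast
  ring

theorem hasDerivWithinAt_dipoleDeriv (hx : HasDerivWithinAt x (v t) s t)
    (hv : HasDerivWithinAt v v' s t) (h0 : x t ≠ 0) (m : E) :
    HasDerivWithinAt (fun t => dipoleDeriv m (x t) (v t))
      (dipoleHessian m (x t) (v t) + dipoleDeriv m (x t) v') s t := by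
  have hn : ‖x t‖ ≠ 0 := norm_ne_zero_iff.2 h0
  have hfirst := (hasDerivWithinAt_inner_left_const hv m).fun_div
    ((hasDerivWithinAt_norm hx h0).fun_pow 3) (pow_ne_zero 3 hn)
  have hsecond := ((hx.inner ℝ hv).fun_mul (hasDerivWithinAt_inner_left_const hx m)).fun_div
    ((hasDerivWithinAt_norm hx h0).fun_pow 5) (pow_ne_zero 5 hn)
  refine (hfirst.fun_sub (hsecond.const_mul 3)).congr_deriv ?_
  simp only [dipoleDeriv, dipoleHessian, real_inner_self_eq_norm_sq, real_inner_comm]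
  field_simp
  push_cast
  ring

end Dipole

section AngularMomentum

variable {x v : ℝ → Plane} {x' v' : Plane} {s : Set ℝ} {t : ℝ}

theorem hasDerivWithinAt_plane_apply (hx : HasDerivWithinAt x x' s t) (i : Fin 2) :
    HasDerivWithinAt (fun t => x t i) (x' i) s t :=
  (EuclideanSpace.proj (𝕜 := ℝ) i).hasFDerivAt.comp_hasDerivWithinAt t hx

theorem hasDerivWithinAt_angularMomentum (hx : HasDerivWithinAt x x' s t)
    (hv : HasDerivWithinAt v v' s t) :
    HasDerivWithinAt (fun t => angularMomentum (x t) (v t))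
      (angularMomentum x' (v t) + angularMomentum (x t) v') s t := by
  refine HasDerivWithinAt.congr_deriv (((hasDerivWithinAt_plane_apply hx 0).fun_mul
    (hasDerivWithinAt_plane_apply hv 1)).fun_sub ((hasDerivWithinAt_plane_apply hv 0).fun_mul
      (hasDerivWithinAt_plane_apply hx 1))) ?_
  simp only [angularMomentum]
  ring

theorem hasDerivWithinAt_angularMomentum_unit (hx : HasDerivWithinAt x x' s t) (h0 : x t ≠ 0)
    (m : Plane) :
    HasDerivWithinAt (fun t => angularMomentum m (x t) / ‖x t‖)
      (angularMomentum (x t) x' * ⟪m, x t⟫ / ‖x t‖ ^ 3) s t := by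
  have hn : ‖x t‖ ≠ 0 := norm_ne_zero_iff.2 h0
  refine ((hasDerivWithinAt_angularMomentum (hasDerivWithinAt_const t s m) hx).fun_div
    (hasDerivWithinAt_norm hx h0) hn).congr_deriv ?_
  simp only [angularMomentum, inner_plane, PiLp.zero_apply]
  field_simp
  rw [norm_sq_plane]
  ring

theorem hasDerivWithinAt_inner_unit (hx : HasDerivWithinAt x x' s t) (h0 : x t ≠ 0) (m : Plane) :
    HasDerivWithinAt (fun t => ⟪m, x t⟫ / ‖x t‖)
      (-(angularMomentum (x t) x' * angularMomentum m (x t) / ‖x t‖ ^ 3)) s t := by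
  have hn : ‖x t‖ ≠ 0 := norm_ne_zero_iff.2 h0
  refine ((hasDerivWithinAt_inner_left_const hx m).fun_div
    (hasDerivWithinAt_norm hx h0) hn).congr_deriv ?_
  simp only [angularMomentum, inner_plane]
  field_simp
  rw [norm_sq_plane]
  ring

end AngularMomentum

/-! ### The Kepler force and the Laplace-Runge-Lenz vector -/

theorem contDiffAt_keplerForce {x : Plane} (hx : x ≠ 0) {n : WithTop ℕ∞} :
    ContDiffAt ℝ n keplerForce x :=
  ((((contDiffAt_norm ℝ hx).pow 3).inv (pow_ne_zero 3 (norm_ne_zero_iff.2 hx))).smul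
    contDiffAt_id).neg

/-- The vector field of the Kepler problem on phase space, whose points are pairs of a position and
a velocity. -/
noncomputable def keplerField (y : Plane × Plane) : Plane × Plane := (y.2, keplerForce y.1)

theorem contDiffAt_keplerField {y : Plane × Plane} (hy : y.1 ≠ 0) {n : WithTop ℕ∞} :
    ContDiffAt ℝ n keplerField y :=
  contDiffAt_snd.prodMk ((contDiffAt_keplerForce hy).fun_comp y contDiffAt_fst)

theorem inner_keplerForce (m x : Plane) : ⟪m, keplerForce x⟫ = -(⟪m, x⟫ / ‖x‖ ^ 3) := by
  rw [keplerForce, inner_neg_right, real_inner_smul_right]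
  ring

theorem angularMomentum_keplerForce (m x : Plane) :
    angularMomentum m (keplerForce x) = -(angularMomentum m x / ‖x‖ ^ 3) := by
  simp only [keplerForce, angularMomentum, PiLp.neg_apply, PiLp.smul_apply, smul_eq_mul]
  ring

theorem angularMomentum_lrlVector (m x v : Plane) :
    angularMomentum m (lrlVector x v) =
      -(angularMomentum x v * ⟪m, v⟫) - angularMomentum m x / ‖x‖ := by
  simp only [lrlVector, angularMomentum, norm_sq_plane, inner_plane, PiLp.sub_apply,
    PiLp.smul_apply, smul_eq_mul]
  ring

theorem inner_lrlVector_left (x v : Plane) :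
    ⟪lrlVector x v, x⟫ = angularMomentum x v ^ 2 - ‖x‖ := by
  have hinv : ‖x‖⁻¹ * ‖x‖ ^ 2 = ‖x‖ := by rw [mul_comm, sq, mul_self_mul_inv]
  rw [lrlVector, inner_sub_left, inner_sub_left, real_inner_smul_left, real_inner_smul_left,
    real_inner_smul_left, real_inner_self_eq_norm_sq, real_inner_comm x v, hinv]
  linear_combination -inner_sq_add_angularMomentum_sq x v

theorem eq_of_forall_angularMomentum_eq {x y : Plane}
    (h : ∀ m, angularMomentum m x = angularMomentum m y) : x = y := by
  ext i
  fin_cases i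
  · simpa [angularMomentum] using h !₂[0, 1]
  · simpa [angularMomentum] using h !₂[1, 0]

/-! ### Kepler orbits -/

theorem eq_of_hasDerivAt_of_contDiffAt {E : Type*} [NormedAddCommGroup E] [NormedSpace ℝ E]
    {F : E → E} {f g : ℝ → E} {t₀ : ℝ} (hF : ∀ t, ContDiffAt ℝ 1 F (g t))
    (hf : ∀ t, HasDerivAt f (F (f t)) t) (hg : ∀ t, HasDerivAt g (F (g t)) t)
    (h₀ : f t₀ = g t₀) : f = g := by
  have hfc : Continuous f := continuous_iff_continuousAt.2 fun t => (hf t).continuousAt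
  have hgc : Continuous g := continuous_iff_continuousAt.2 fun t => (hg t).continuousAt
  have hopen : IsOpen {t | f t = g t} := by
    refine isOpen_iff_mem_nhds.2 fun t ht => ?_
    obtain ⟨K, s, hs, hLip⟩ := (hF t).exists_lipschitzOnWith
    have hfs : ∀ᶠ τ in 𝓝 t, f τ ∈ s := hfc.continuousAt ((show f t = g t from ht) ▸ hs)
    exact ODE_solution_unique_of_eventually (v := fun _ => F) (s := fun _ => s)
      (.of_forall fun _ => hLip) (hfs.mono fun τ hτ => ⟨hf τ, hτ⟩)
      (Eventually.mono (hgc.continuousAt hs) fun τ hτ => ⟨hg τ, hτ⟩) ht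
  have huniv := IsClopen.eq_univ ⟨isClosed_eq hfc hgc, hopen⟩ ⟨t₀, h₀⟩
  exact funext fun t => (huniv ▸ mem_univ t : t ∈ {t | f t = g t})

theorem contDiff_of_hasDerivAt_comp {E : Type*} [NormedAddCommGroup E] [NormedSpace ℝ E]
    {F : E → E} {f : ℝ → E} {n : ℕ} (hF : ∀ t, ContDiffAt ℝ n F (f t))
    (hf : ∀ t, HasDerivAt f (F (f t)) t) : ContDiff ℝ n f := by
  induction n with
  | zero => exact contDiff_zero.2 (continuous_iff_continuousAt.2 fun t => (hf t).continuousAt)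
  | succ n ih =>
    have hFn (t : ℝ) : ContDiffAt ℝ n F (f t) := (hF t).of_le (by simp)
    push_cast
    refine contDiff_succ_iff_deriv.2 ⟨fun t => (hf t).differentiableAt, by simp, ?_⟩
    rw [funext fun t => (hf t).deriv]
    exact contDiff_iff_contDiffAt.2 fun t => (hFn t).fun_comp t (ih hFn).contDiffAt

theorem eq_of_hasDerivAt_zero {f : ℝ → ℝ} (hf : ∀ t, HasDerivAt f 0 t) (a b : ℝ) : f a = f b :=
  is_const_of_deriv_eq_zero (fun t => (hf t).differentiableAt) (fun t => (hf t).deriv) a b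

theorem mul_cos_add_mul_sin_eq {c d φ w : ℝ → ℝ} (hc : ∀ t, HasDerivAt c (-(w t * d t)) t)
    (hd : ∀ t, HasDerivAt d (w t * c t) t) (hφ : ∀ t, HasDerivAt φ (w t) t) (a b : ℝ) :
    c a * Real.cos (φ a) + d a * Real.sin (φ a) = c b * Real.cos (φ b) + d b * Real.sin (φ b) := by
  refine eq_of_hasDerivAt_zero (fun t => ?_) a b
    (f := fun t => c t * Real.cos (φ t) + d t * Real.sin (φ t))
  refine (((hc t).fun_mul (hφ t).cos).fun_add ((hd t).fun_mul (hφ t).sin)).congr_deriv ?_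
  ring

theorem eq_two_pi_of_isLeast {ψ : ℝ → ℝ} {T : ℝ} (hmono : StrictMono ψ) (hcont : Continuous ψ)
    (h0 : ψ 0 = 0) (hT : IsLeast {τ | 0 < τ ∧ Real.cos (ψ τ) = 1} T) : ψ T = 2 * Real.pi := by
  have hpos : 0 < ψ T := h0 ▸ hmono hT.1.1
  have hle : 2 * Real.pi ≤ ψ T := by
    obtain ⟨k, hk⟩ := (Real.cos_eq_one_iff _).1 hT.1.2
    have hk0 : (0 : ℝ) < k := pos_of_mul_pos_left (hk ▸ hpos) Real.two_pi_pos.le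
    have hk1 : (1 : ℝ) ≤ k := by exact_mod_cast hk0
    rw [← hk]
    exact le_mul_of_one_le_left Real.two_pi_pos.le hk1
  obtain ⟨τ, hτ, hψτ⟩ := intermediate_value_Icc hT.1.1.le hcont.continuousOn
    (show 2 * Real.pi ∈ Icc (ψ 0) (ψ T) from ⟨h0.trans_le Real.two_pi_pos.le, hle⟩)
  have hτ0 : 0 < τ := hmono.lt_iff_lt.1 (by rw [h0, hψτ]; exact Real.two_pi_pos)
  have hTτ : T ≤ τ := hT.2 ⟨hτ0, by rw [hψτ, Real.cos_two_pi]⟩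
  rw [hTτ.antisymm hτ.2, hψτ]

namespace IsKeplerSolution

variable {X V : ℝ → Plane} (hX : IsKeplerSolution X V)
include hX

theorem norm_pos (t : ℝ) : 0 < ‖X t‖ := norm_pos_iff.2 (hX.ne_zero t)

theorem angularMomentum_eq (t : ℝ) :
    angularMomentum (X t) (V t) = angularMomentum (X 0) (V 0) := by
  refine eq_of_hasDerivAt_zero (fun t => ?_) t 0 (f := fun t => angularMomentum (X t) (V t))
  rw [← hasDerivWithinAt_univ]
  refine (hasDerivWithinAt_angularMomentum (hX.hasDerivAt_pos t).hasDerivWithinAt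
    (hX.hasDerivAt_vel t).hasDerivWithinAt).congr_deriv ?_
  rw [angularMomentum_keplerForce, angularMomentum_self, angularMomentum_self]
  simp

theorem hasDerivAt_inner_unit (m : Plane) (t : ℝ) :
    HasDerivAt (fun t => ⟪m, X t⟫ / ‖X t‖)
      (-(angularMomentum (X 0) (V 0) / ‖X t‖ ^ 2 * (angularMomentum m (X t) / ‖X t‖))) t := by
  rw [← hasDerivWithinAt_univ]
  refine (hasDerivWithinAt_inner_unit (hX.hasDerivAt_pos t).hasDerivWithinAt
    (hX.ne_zero t) m).congr_deriv ?_
  rw [hX.angularMomentum_eq, div_mul_div_comm, ← pow_succ]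

theorem hasDerivAt_angularMomentum_unit (m : Plane) (t : ℝ) :
    HasDerivAt (fun t => angularMomentum m (X t) / ‖X t‖)
      (angularMomentum (X 0) (V 0) / ‖X t‖ ^ 2 * (⟪m, X t⟫ / ‖X t‖)) t := by
  rw [← hasDerivWithinAt_univ]
  refine (hasDerivWithinAt_angularMomentum_unit (hX.hasDerivAt_pos t).hasDerivWithinAt
    (hX.ne_zero t) m).congr_deriv ?_
  rw [hX.angularMomentum_eq, div_mul_div_comm, ← pow_succ]

theorem lrlVector_eq (t : ℝ) : lrlVector (X t) (V t) = lrlVector (X 0) (V 0) := by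
  refine eq_of_forall_angularMomentum_eq fun m => ?_
  rw [angularMomentum_lrlVector, angularMomentum_lrlVector, hX.angularMomentum_eq]
  refine eq_of_hasDerivAt_zero (fun t => ?_) t 0 (f := fun t =>
    -(angularMomentum (X 0) (V 0) * ⟪m, V t⟫) - angularMomentum m (X t) / ‖X t‖)
  have hV := hasDerivWithinAt_inner_left_const (s := univ) (hX.hasDerivAt_vel t).hasDerivWithinAt m
  rw [hasDerivWithinAt_univ] at hV
  refine ((hV.const_mul _).fun_neg.fun_sub (hX.hasDerivAt_angularMomentum_unit m t)).congr_deriv ?_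
  rw [inner_keplerForce]
  ring

theorem norm_eq (t : ℝ) :
    ‖X t‖ = angularMomentum (X 0) (V 0) ^ 2 - ⟪lrlVector (X 0) (V 0), X t⟫ := by
  rw [← hX.lrlVector_eq t, inner_lrlVector_left, ← hX.angularMomentum_eq t]
  ring

theorem continuous_pos : Continuous X :=
  continuous_iff_continuousAt.2 fun t => (hX.hasDerivAt_pos t).continuousAt

theorem hasDerivAt_phase (t : ℝ) :
    HasDerivAt (fun t => (X t, V t)) (keplerField (X t, V t)) t :=
  (hX.hasDerivAt_pos t).prodMk (hX.hasDerivAt_vel t)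

theorem contDiff_phase {n : ℕ} : ContDiff ℝ n fun t => (X t, V t) :=
  contDiff_of_hasDerivAt_comp (fun t => contDiffAt_keplerField (hX.ne_zero t)) hX.hasDerivAt_phase

theorem periodic_of_eq {τ : ℝ} (hXτ : X τ = X 0) (hVτ : V τ = V 0) : Function.Periodic X τ := by
  have heq : (fun t => (X (t + τ), V (t + τ))) = fun t => (X t, V t) :=
    eq_of_hasDerivAt_of_contDiffAt (t₀ := 0) (fun t => contDiffAt_keplerField (hX.ne_zero t))
      (fun t => (hX.hasDerivAt_phase (t + τ)).comp_add_const t τ) hX.hasDerivAt_phase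
      (by simp [hXτ, hVτ])
  exact fun t => congrArg Prod.fst (congrFun heq t)

theorem vel_eq_of_pos_eq (hL : angularMomentum (X 0) (V 0) ≠ 0) {τ : ℝ} (hτ : X τ = X 0) :
    V τ = V 0 := by
  refine ext_inner_left ℝ fun m => mul_left_cancel₀ hL ?_
  have hlrl := congrArg (angularMomentum m) (hX.lrlVector_eq τ)
  rw [angularMomentum_lrlVector, angularMomentum_lrlVector, hX.angularMomentum_eq, hτ] at hlrl
  linarith

theorem vel_eq_of_periodic {τ : ℝ} (hτ : Function.Periodic X τ) : V τ = V 0 := by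
  have hderiv := (hX.hasDerivAt_pos (0 + τ)).comp_add_const 0 τ
  rw [funext hτ] at hderiv
  simpa using hderiv.unique (hX.hasDerivAt_pos 0)

theorem exists_polarAngle : ∃ φ : ℝ → ℝ, φ 0 = 0 ∧
    ∀ t, HasDerivAt φ (angularMomentum (X 0) (V 0) / ‖X t‖ ^ 2) t := by
  have hc : Continuous fun t => angularMomentum (X 0) (V 0) / ‖X t‖ ^ 2 :=
    continuous_const.div (hX.continuous_pos.norm.pow 2) fun t => pow_ne_zero 2 (hX.norm_pos t).ne'
  exact ⟨fun t => ∫ s in (0 : ℝ)..t, angularMomentum (X 0) (V 0) / ‖X s‖ ^ 2, by simp,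
    fun t => hc.integral_hasStrictDerivAt 0 t |>.hasDerivAt⟩

section PolarAngle

variable {φ : ℝ → ℝ} (hφ0 : φ 0 = 0)
  (hφ : ∀ t, HasDerivAt φ (angularMomentum (X 0) (V 0) / ‖X t‖ ^ 2) t)
include hφ0 hφ

theorem inner_unit_rotation (m : Plane) (t : ℝ) :
    ⟪m, X t⟫ / ‖X t‖ * Real.cos (φ t) + angularMomentum m (X t) / ‖X t‖ * Real.sin (φ t) =
      ⟪m, X 0⟫ / ‖X 0‖ := by
  simpa [hφ0] using mul_cos_add_mul_sin_eq (hX.hasDerivAt_inner_unit m)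
    (hX.hasDerivAt_angularMomentum_unit m) hφ t 0

theorem cos_polarAngle_of_periodic {τ : ℝ} (hτ : Function.Periodic X τ) :
    Real.cos (φ τ) = 1 := by
  have hrot := hX.inner_unit_rotation hφ0 hφ (X 0) τ
  have hne : ⟪X 0, X 0⟫ / ‖X 0‖ ≠ 0 :=
    div_ne_zero (inner_self_ne_zero.2 (hX.ne_zero 0)) (hX.norm_pos 0).ne'
  rw [hτ.eq, angularMomentum_self, zero_div, zero_mul, add_zero] at hrot
  exact mul_left_cancel₀ hne (hrot.trans (mul_one _).symm)

theorem pos_eq_of_cos_polarAngle (hL : angularMomentum (X 0) (V 0) ≠ 0) {τ : ℝ}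
    (hτ : Real.cos (φ τ) = 1) : X τ = X 0 := by
  have hsin : Real.sin (φ τ) = 0 := Real.sin_eq_zero_iff_cos_eq.2 (Or.inl hτ)
  have hunit (m : Plane) : ⟪m, X τ⟫ / ‖X τ‖ = ⟪m, X 0⟫ / ‖X 0‖ := by
    simpa [hτ, hsin] using hX.inner_unit_rotation hφ0 hφ m τ
  have hnorm : ‖X τ‖ = ‖X 0‖ := by
    have hcross := hunit (lrlVector (X 0) (V 0))
    rw [div_eq_div_iff (hX.norm_pos τ).ne' (hX.norm_pos 0).ne'] at hcross
    refine mul_left_cancel₀ (pow_ne_zero 2 hL) ?_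
    linear_combination ‖X 0‖ * hX.norm_eq τ - ‖X τ‖ * hX.norm_eq 0 - hcross
  refine ext_inner_left ℝ fun m => ?_
  simpa [hnorm, div_left_inj' (hX.norm_pos 0).ne'] using hunit m

theorem periodic_iff_cos_polarAngle (hL : angularMomentum (X 0) (V 0) ≠ 0) {τ : ℝ} :
    Function.Periodic X τ ↔ Real.cos (φ τ) = 1 := by
  refine ⟨hX.cos_polarAngle_of_periodic hφ0 hφ, fun hτ => ?_⟩
  have hXτ := hX.pos_eq_of_cos_polarAngle hφ0 hφ hL hτ
  exact hX.periodic_of_eq hXτ (hX.vel_eq_of_pos_eq hL hXτ)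

theorem polarAngle_minimalPeriod (hL : angularMomentum (X 0) (V 0) ≠ 0) {T : ℝ}
    (hT : IsMinimalPeriod X T) :
    φ T = Real.sign (angularMomentum (X 0) (V 0)) * (2 * Real.pi) := by
  set L := angularMomentum (X 0) (V 0)
  have hsign : Real.sign L * Real.sign L = 1 := by
    rcases Real.sign_apply_eq_of_ne_zero L hL with h | h <;> rw [h] <;> norm_num
  have hcos (t : ℝ) : Real.cos (Real.sign L * φ t) = Real.cos (φ t) := by
    rcases Real.sign_apply_eq_of_ne_zero L hL with h | h <;> simp [h]
  have hderiv (t : ℝ) : HasDerivAt (fun t => Real.sign L * φ t)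
      (Real.sign L * (L / ‖X t‖ ^ 2)) t := (hφ t).const_mul _
  have hmono : StrictMono fun t => Real.sign L * φ t := strictMono_of_deriv_pos fun t => by
    rw [(hderiv t).deriv, ← mul_div_assoc]
    exact div_pos (Real.sign_mul_pos_of_ne_zero L hL) (pow_pos (hX.norm_pos t) 2)
  have hleast : IsLeast {τ | 0 < τ ∧ Real.cos (Real.sign L * φ τ) = 1} T := by
    simp_rw [hcos, ← hX.periodic_iff_cos_polarAngle hφ0 hφ hL]
    exact hT
  rw [← eq_two_pi_of_isLeast hmono
    (continuous_iff_continuousAt.2 fun t => (hderiv t).continuousAt) (by simp [hφ0]) hleast,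
    ← mul_assoc, hsign, one_mul]

end PolarAngle

end IsKeplerSolution

/-! ### The drift of the Laplace-Runge-Lenz vector over a revolution -/

theorem hasDerivAt_polar_primitive {c d φ : ℝ → ℝ} {e w t : ℝ}
    (hc : HasDerivAt c (-(w * d t)) t) (hd : HasDerivAt d (w * c t) t) (hφ : HasDerivAt φ w t)
    (hcd : c t ^ 2 + d t ^ 2 = e) :
    HasDerivAt (fun t => d t + 3 / 2 * (c t * d t) + (2 * e * d t + c t ^ 2 * d t) +
        (c t ^ 3 * d t / 4 + 3 * e / 8 * (c t * d t)) + (3 / 2 * e + 3 / 8 * e ^ 2) * φ t)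
      (w * (c t * (1 + c t) ^ 3)) t := by
  have hcd' := hc.fun_mul hd
  refine ((((hd.fun_add (hcd'.const_mul (3 / 2))).fun_add
    ((hd.const_mul (2 * e)).fun_add ((hc.fun_pow 2).fun_mul hd))).fun_add
    ((((hc.fun_pow 3).fun_mul hd).div_const 4).fun_add (hcd'.const_mul (3 * e / 8)))).fun_add
    (hφ.const_mul (3 / 2 * e + 3 / 8 * e ^ 2))).congr_deriv ?_
  push_cast
  linear_combination (-w) * (3 / 2 + 2 * c t + 3 / 4 * c t ^ 2 + 3 * e / 8) * hcd

namespace IsKeplerSolution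

variable {X V : ℝ → Plane} (hX : IsKeplerSolution X V)
include hX

theorem hasDerivAt_dipoleDeriv (t : ℝ) :
    HasDerivAt (fun t => dipoleDeriv (lrlVector (X 0) (V 0)) (X t) (V t))
      (dipoleHessian (lrlVector (X 0) (V 0)) (X t) (V t) +
        2 * (⟪lrlVector (X 0) (V 0), X t⟫ / ‖X t‖ ^ 6)) t := by
  rw [← hasDerivWithinAt_univ]
  refine (hasDerivWithinAt_dipoleDeriv (hX.hasDerivAt_pos t).hasDerivWithinAt
    (hX.hasDerivAt_vel t).hasDerivWithinAt (hX.ne_zero t) _).congr_deriv ?_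
  have hn := (hX.norm_pos t).ne'
  rw [dipoleDeriv, inner_keplerForce, inner_keplerForce, real_inner_self_eq_norm_sq]
  field_simp
  ring

theorem norm_mul_one_add_inner_unit (t : ℝ) :
    ‖X t‖ * (1 + ⟪lrlVector (X 0) (V 0), X t⟫ / ‖X t‖) = angularMomentum (X 0) (V 0) ^ 2 := by
  have hn := (hX.norm_pos t).ne'
  have horbit := hX.norm_eq t
  field_simp
  linarith

theorem exists_primitive_dipoleHessian (hL : angularMomentum (X 0) (V 0) ≠ 0) {T : ℝ}
    (hT : IsMinimalPeriod X T) :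
    ∃ W : ℝ → ℝ, (∀ t, HasDerivAt W (dipoleHessian (lrlVector (X 0) (V 0)) (X t) (V t)) t) ∧
      W T - W 0 = -(Real.pi * (6 * ‖lrlVector (X 0) (V 0)‖ ^ 2 +
        3 / 2 * ‖lrlVector (X 0) (V 0)‖ ^ 4) * Real.sign (angularMomentum (X 0) (V 0))) /
          angularMomentum (X 0) (V 0) ^ 7 := by
  obtain ⟨φ, hφ0, hφ⟩ := hX.exists_polarAngle
  have hφT := hX.polarAngle_minimalPeriod hφ0 hφ hL hT
  have hXT : X T = X 0 := hT.1.2.eq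
  have hVT : V T = V 0 := hX.vel_eq_of_periodic hT.1.2
  set m := lrlVector (X 0) (V 0)
  set L := angularMomentum (X 0) (V 0)
  have hcd (t : ℝ) :
      (⟪m, X t⟫ / ‖X t‖) ^ 2 + (angularMomentum m (X t) / ‖X t‖) ^ 2 = ‖m‖ ^ 2 := by
    rw [div_pow, div_pow, ← add_div, inner_sq_add_angularMomentum_sq,
      mul_div_cancel_right₀ _ (pow_ne_zero 2 (hX.norm_pos t).ne')]
  have hpolar := fun t => hasDerivAt_polar_primitive (c := fun t => ⟪m, X t⟫ / ‖X t‖)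
    (d := fun t => angularMomentum m (X t) / ‖X t‖) (hX.hasDerivAt_inner_unit m t)
    (hX.hasDerivAt_angularMomentum_unit m t) (hφ t) (hcd t)
  refine ⟨_, fun t => ((hX.hasDerivAt_dipoleDeriv t).fun_sub
    ((hpolar t).const_mul (2 / L ^ 7))).congr_deriv ?_, ?_⟩
  · have hn := (hX.norm_pos t).ne'
    have hpow : L ^ 7 = L * (‖X t‖ * (1 + ⟪m, X t⟫ / ‖X t‖)) ^ 3 := by
      rw [hX.norm_mul_one_add_inner_unit]
      ring
    have hradial : L / ‖X t‖ ^ 2 * (⟪m, X t⟫ / ‖X t‖ * (1 + ⟪m, X t⟫ / ‖X t‖) ^ 3) =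
        L ^ 7 * (⟪m, X t⟫ / ‖X t‖ ^ 6) := by
      rw [hpow]
      field_simp
    rw [hradial]
    field_simp
    ring
  · simp only [hXT, hVT, hφT, hφ0]
    field_simp
    ring

end IsKeplerSolution

/-! ### The shape of the orbit -/

theorem eq_zero_of_forall_circle {α β γ δ ε ζ : ℝ} (h : ∀ C D : ℝ, C ^ 2 + D ^ 2 = 1 →
      α * C ^ 2 + β * D ^ 2 + γ * (C * D) + δ * C + ε * D + ζ = 0) :
    α + ζ = 0 ∧ β + ζ = 0 ∧ γ = 0 ∧ δ = 0 ∧ ε = 0 := by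
  have heast := h 1 0 (by norm_num)
  have hwest := h (-1) 0 (by norm_num)
  have hnorth := h 0 1 (by norm_num)
  have hsouth := h 0 (-1) (by norm_num)
  have hdiag := h (3 / 5) (4 / 5) (by norm_num)
  refine ⟨?_, ?_, ?_, ?_, ?_⟩ <;> linarith

theorem ellipse_conic_parameters {a b ℓ r₁ r₂ c₁ c₂ : ℝ} (hb : 0 < b) (hba : b < a) (hℓ : 0 ≤ ℓ)
    (h : ∀ C D : ℝ, C ^ 2 + D ^ 2 = 1 → (c₁ + a * C) ^ 2 + (c₂ + b * D) ^ 2 =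
      (ℓ - (r₁ * (c₁ + a * C) + r₂ * (c₂ + b * D))) ^ 2) :
    ℓ = b ^ 2 / a ∧ r₁ ^ 2 + r₂ ^ 2 = 1 - b ^ 2 / a ^ 2 := by
  have ha : 0 < a := hb.trans hba
  obtain ⟨μ, rfl⟩ : ∃ μ, ℓ = μ + r₁ * c₁ + r₂ * c₂ := ⟨ℓ - r₁ * c₁ - r₂ * c₂, by ring⟩
  obtain ⟨hC, hD, hCD, hc₁, hc₂⟩ := eq_zero_of_forall_circle
    (α := a ^ 2 * (1 - r₁ ^ 2)) (β := b ^ 2 * (1 - r₂ ^ 2)) (γ := -(2 * (a * b) * (r₁ * r₂)))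
    (δ := 2 * a * (c₁ + μ * r₁)) (ε := 2 * b * (c₂ + μ * r₂)) (ζ := c₁ ^ 2 + c₂ ^ 2 - μ ^ 2)
    fun C D hcircle => by linear_combination h C D hcircle
  obtain rfl : c₁ = -(μ * r₁) := by
    linarith [(mul_eq_zero_iff_left (mul_pos two_pos ha).ne').1 hc₁]
  obtain rfl : c₂ = -(μ * r₂) := by
    linarith [(mul_eq_zero_iff_left (mul_pos two_pos hb).ne').1 hc₂]
  have hr : r₁ * r₂ = 0 :=
    (mul_eq_zero_iff_left (mul_pos two_pos (mul_pos ha hb)).ne').1 (neg_eq_zero.1 hCD)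
  obtain rfl : r₂ = 0 := (mul_eq_zero.1 hr).resolve_left fun hr₁ => by
    subst hr₁
    nlinarith [mul_nonneg (sq_nonneg r₂) (sq_nonneg b)]
  have hr₁ : a ^ 2 * r₁ ^ 2 = a ^ 2 - b ^ 2 := by linarith
  have hμ : μ ^ 2 = a ^ 2 := by
    have hb2 : b ^ 2 ≠ 0 := pow_ne_zero 2 hb.ne'
    refine mul_left_cancel₀ hb2 ?_
    linear_combination (-(a ^ 2)) * hC + (μ ^ 2 - a ^ 2) * hr₁
  obtain rfl : μ = a := (sq_eq_sq_iff_eq_or_eq_neg.1 hμ).resolve_right fun hμa => by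
    subst hμa
    nlinarith [mul_pos ha (pow_pos hb 2), mul_nonneg (pow_nonneg ha.le 2) hℓ]
  constructor <;> field_simp <;> linarith

theorem inner_rotPlane (p u : Plane) : ⟪p, rotPlane u⟫ = angularMomentum u p := by
  simp only [inner_plane, rotPlane, angularMomentum, Matrix.cons_val_zero, Matrix.cons_val_one]
  ring

theorem exists_inner_eq_angularMomentum_eq {u : Plane} (hu : ‖u‖ = 1) (s r : ℝ) :
    ∃ p : Plane, ⟪p, u⟫ = s ∧ angularMomentum u p = r := by
  have hu2 : ⟪u, u⟫ = 1 := by rw [real_inner_self_eq_norm_sq, hu, one_pow]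
  have hrot : angularMomentum u (rotPlane u) = 1 := by
    rw [← hu2]
    simp only [inner_plane, rotPlane, angularMomentum, Matrix.cons_val_zero, Matrix.cons_val_one]
    ring
  refine ⟨s • u + r • rotPlane u, ?_, ?_⟩
  · rw [inner_add_left, real_inner_smul_left, real_inner_smul_left, real_inner_comm u (rotPlane u),
      inner_rotPlane, angularMomentum_self, hu2]
    ring
  · rw [angularMomentum_add_right, angularMomentum_smul_right, angularMomentum_smul_right,
      angularMomentum_self, hrot]
    ring

theorem IsEllipse.conic_parameters {S : Set Plane} {a b ℓ : ℝ} {m : Plane} (hS : IsEllipse S a b)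
    (hba : b < a) (hℓ : 0 ≤ ℓ) (h : ∀ p ∈ S, ‖p‖ = ℓ - ⟪m, p⟫) :
    ℓ = b ^ 2 / a ∧ ‖m‖ ^ 2 = 1 - b ^ 2 / a ^ 2 := by
  obtain ⟨hb, -, c, u, hu, rfl⟩ := hS
  have ha : 0 < a := hb.trans hba
  have hnorm (p : Plane) : ‖p‖ ^ 2 = ⟪p, u⟫ ^ 2 + angularMomentum u p ^ 2 := by
    rw [real_inner_comm, inner_sq_add_angularMomentum_sq, hu, one_pow, one_mul]
  have hinner (p : Plane) :
      ⟪m, p⟫ = ⟪m, u⟫ * ⟪p, u⟫ + angularMomentum u m * angularMomentum u p := by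
    have hu2 : u 0 ^ 2 + u 1 ^ 2 = 1 := by rw [← norm_sq_plane, hu, one_pow]
    simp only [inner_plane, angularMomentum]
    linear_combination (-(m 0 * p 0) - m 1 * p 1) * hu2
  rw [hnorm m]
  refine ellipse_conic_parameters (c₁ := ⟪c, u⟫) (c₂ := angularMomentum u c) hb hba hℓ
    fun C D hCD => ?_
  obtain ⟨p, hpu, hpr⟩ := exists_inner_eq_angularMomentum_eq hu (⟪c, u⟫ + a * C)
    (angularMomentum u c + b * D)
  have hp : (⟪p - c, u⟫ / a) ^ 2 + (⟪p - c, rotPlane u⟫ / b) ^ 2 = 1 := by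
    rw [inner_sub_left, inner_rotPlane, angularMomentum_sub_right, hpu, hpr, add_sub_cancel_left,
      add_sub_cancel_left, mul_div_cancel_left₀ _ ha.ne', mul_div_cancel_left₀ _ hb.ne', hCD]
  rw [← hpu, ← hpr, ← hnorm, ← hinner, h p hp]

namespace IsKeplerSolution

variable {X V : ℝ → Plane} (hX : IsKeplerSolution X V)
include hX

theorem angularMomentum_sq_and_norm_lrlVector_sq {a b : ℝ} (horbit : IsEllipse (range X) a b)
    (hba : b < a) : angularMomentum (X 0) (V 0) ^ 2 = b ^ 2 / a ∧
      ‖lrlVector (X 0) (V 0)‖ ^ 2 = 1 - b ^ 2 / a ^ 2 :=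
  horbit.conic_parameters hba (sq_nonneg _) (forall_mem_range.2 hX.norm_eq)

end IsKeplerSolution

theorem precession_coefficient {a b L e : ℝ} (ha : a ≠ 0) (hb : b ≠ 0) (hL : L ^ 2 = b ^ 2 / a)
    (he : e ^ 2 = 1 - b ^ 2 / a ^ 2) (he0 : e ≠ 0) :
    L / 12 * (-(Real.pi * (6 * e ^ 2 + 3 / 2 * e ^ 4) * Real.sign L) / L ^ 7) / e ^ 2 =
      -(Real.sign L * (Real.pi / 24) * (15 * (a ^ 3 / b ^ 6) - 3 * (a / b ^ 4))) := by
  have hL0 : L ≠ 0 := by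
    rintro rfl
    exact div_ne_zero (pow_ne_zero 2 hb) ha (hL ▸ zero_pow two_ne_zero)
  have hcancel : L / 12 * (-(Real.pi * (6 * e ^ 2 + 3 / 2 * e ^ 4) * Real.sign L) / L ^ 7) /
      e ^ 2 = -(Real.sign L * (Real.pi / 24) * (12 + 3 * e ^ 2) / (L ^ 2) ^ 3) := by
    field_simp
    ring
  rw [hcancel, he, hL]
  field_simp
  ring

namespace IsKeplerSolution

variable {X V : ℝ → Plane} (hX : IsKeplerSolution X V) {a b : ℝ}
  (horbit : IsEllipse (range X) a b) (hba : b < a)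
include hX horbit hba

theorem angularMomentum_ne_zero : angularMomentum (X 0) (V 0) ≠ 0 := fun h0 =>
  (div_pos (pow_pos horbit.1 2) (horbit.1.trans hba)).ne'
    ((hX.angularMomentum_sq_and_norm_lrlVector_sq horbit hba).1.symm.trans (by simp [h0]))

theorem lrlVector_ne_zero : lrlVector (X 0) (V 0) ≠ 0 := fun h0 => by
  have ha := horbit.1.trans hba
  have hlt : b ^ 2 / a ^ 2 < 1 := by
    rw [div_lt_one (pow_pos ha 2)]
    exact pow_lt_pow_left₀ hba horbit.1.le two_ne_zero
  have hsq := (hX.angularMomentum_sq_and_norm_lrlVector_sq horbit hba).2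
  rw [h0, norm_zero] at hsq
  linarith

theorem exists_primitive_dipoleHessian_of_isEllipse {T : ℝ} (hT : IsMinimalPeriod X T) :
    ∃ W : ℝ → ℝ, (∀ t, HasDerivAt W (dipoleHessian (lrlVector (X 0) (V 0)) (X t) (V t)) t) ∧
      angularMomentum (X 0) (V 0) / 12 * (W T - W 0) / ‖lrlVector (X 0) (V 0)‖ ^ 2 =
        -(Real.sign (angularMomentum (X 0) (V 0)) * (Real.pi / 24) *
          (15 * (a ^ 3 / b ^ 6) - 3 * (a / b ^ 4))) := by
  obtain ⟨W, hW, hWT⟩ :=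
    hX.exists_primitive_dipoleHessian (hX.angularMomentum_ne_zero horbit hba) hT
  obtain ⟨hL2, hm2⟩ := hX.angularMomentum_sq_and_norm_lrlVector_sq horbit hba
  refine ⟨W, hW, ?_⟩
  rw [hWT]
  exact precession_coefficient (horbit.1.trans hba).ne' horbit.1.ne' hL2 hm2
    (norm_ne_zero_iff.2 (hX.lrlVector_ne_zero horbit hba))

end IsKeplerSolution

/-! ### The trapezoidal rule along a straight line -/

theorem isBigO_symm_second_difference {E F : Type*} [NormedAddCommGroup E] [NormedSpace ℝ E]
    [NormedAddCommGroup F] [NormedSpace ℝ F] {f : E → F} {x₀ : E} (hf : ContDiffAt ℝ 2 f x₀)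
    (d₀ : E) :
    (fun q : (E × E) × ℝ => f (q.1.1 + q.2 • q.1.2) + f (q.1.1 - q.2 • q.1.2) -
      (2 : ℝ) • f q.1.1) =O[𝓝 (x₀, d₀) ×ˢ 𝓝 0] fun q => q.2 ^ 2 := by
  have hz : Tendsto (fun q : (E × E) × ℝ => q.1.1) (𝓝 (x₀, d₀) ×ˢ 𝓝 0) (𝓝 x₀) :=
    tendsto_fst.fst_nhds
  have hd : Tendsto (fun q : (E × E) × ℝ => q.1.2) (𝓝 (x₀, d₀) ×ˢ 𝓝 0) (𝓝 d₀) :=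
    tendsto_fst.snd_nhds
  have hplus : Tendsto (fun q : (E × E) × ℝ => q.1.1 + q.2 • q.1.2) (𝓝 (x₀, d₀) ×ˢ 𝓝 0)
      (𝓝 x₀) := by
    simpa using hz.add (tendsto_snd.smul hd)
  have hminus : Tendsto (fun q : (E × E) × ℝ => q.1.1 - q.2 • q.1.2) (𝓝 (x₀, d₀) ×ˢ 𝓝 0)
      (𝓝 x₀) := by
    simpa using hz.sub (tendsto_snd.smul hd)
  have hdiff : ∀ᶠ x in 𝓝 x₀, HasFDerivAt f (fderiv ℝ f x) x :=
    (hf.eventually (by simp)).mono fun x hx => (hx.differentiableAt (by simp)).hasFDerivAt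
  have hfderiv : (fun q : (E × E) × ℝ => fderiv ℝ f (q.1.1 + q.2 • q.1.2) -
      fderiv ℝ f (q.1.1 - q.2 • q.1.2)) =O[𝓝 (x₀, d₀) ×ˢ 𝓝 0] fun q => q.2 := by
    refine ((((hf.fderiv_right (m := 1) le_rfl).hasStrictFDerivAt one_ne_zero).isBigO_sub
      ).comp_tendsto (hplus.prodMk_nhds hminus)).trans ?_
    have hdist := ((isBigO_refl (fun q : (E × E) × ℝ => q.2) (𝓝 (x₀, d₀) ×ˢ 𝓝 0)).const_mul_left
      2).smul (hd.isBigO_one ℝ)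
    refine (hdist.congr_left fun q => ?_).trans (by simpa using isBigO_refl _ _)
    simp only [Function.comp_apply]
    module
  refine isBigO_pow_succ_of_hasDerivAt (n := 1) (e' := fun q => (fderiv ℝ f (q.1.1 + q.2 • q.1.2) -
    fderiv ℝ f (q.1.1 - q.2 • q.1.2)) q.1.2) ?_ (fun q => by simp [two_smul]) ?_
  · filter_upwards [hplus.eventually hdiff, hminus.eventually hdiff] with q hqp hqm
    have hline : HasDerivAt (fun s : ℝ => s • q.1.2) q.1.2 q.2 := by
      simpa using (hasDerivAt_id q.2).smul_const q.1.2
    refine (((hqp.comp_hasDerivAt q.2 (hline.const_add q.1.1)).add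
      (hqm.comp_hasDerivAt q.2 (hline.const_sub q.1.1))).sub_const _).congr_deriv ?_
    simp [sub_eq_add_neg]
  · simpa using isBoundedBilinearMap_apply.isBigO_comp.trans
      (hfderiv.norm_left.mul (hd.isBigO_one ℝ).norm_left)

theorem hasDerivWithinAt_line {E : Type*} [NormedAddCommGroup E] [NormedSpace ℝ E] (z p : E)
    (σ : ℝ) :
    HasDerivWithinAt (fun s => z + s • p) p univ σ := by
  simpa using ((hasDerivWithinAt_id σ univ).smul_const p).const_add z

section Line

variable {E : Type*} [NormedAddCommGroup E] [InnerProductSpace ℝ E]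

theorem contDiffAt_dipoleHessian (m : E) {y : E × E} (hy : y.1 ≠ 0)
    {n : WithTop ℕ∞} :
    ContDiffAt ℝ n (fun y : E × E => dipoleHessian m y.1 y.2) y := by
  have h0 : ‖y.1‖ ≠ 0 := norm_ne_zero_iff.2 hy
  have hn : ContDiffAt ℝ n (fun y : E × E => ‖y.1‖) y := contDiffAt_fst.norm ℝ hy
  have hxv : ContDiffAt ℝ n (fun y : E × E => ⟪y.1, y.2⟫) y :=
    contDiffAt_fst.inner ℝ contDiffAt_snd
  have hmx : ContDiffAt ℝ n (fun y : E × E => ⟪m, y.1⟫) y :=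
    contDiffAt_const.inner ℝ contDiffAt_fst
  have hmv : ContDiffAt ℝ n (fun y : E × E => ⟪m, y.2⟫) y :=
    contDiffAt_const.inner ℝ contDiffAt_snd
  exact ((contDiffAt_const.mul ((hxv.mul hmv).div (hn.pow 5) (pow_ne_zero 5 h0))).sub
    (contDiffAt_const.mul (((contDiffAt_snd.norm_sq ℝ).mul hmx).div (hn.pow 5)
      (pow_ne_zero 5 h0)))).add
    (contDiffAt_const.mul (((hxv.pow 2).mul hmx).div (hn.pow 7) (pow_ne_zero 7 h0)))

variable (m : E) {z₀ : E} (hz₀ : z₀ ≠ 0) (p₀ : E)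

include hz₀

theorem eventually_line_ne_zero :
    ∀ᶠ q : (E × E) × ℝ in 𝓝 (z₀, p₀) ×ˢ 𝓝 0,
      q.1.1 + q.2 • q.1.2 ≠ 0 ∧ q.1.1 - q.2 • q.1.2 ≠ 0 := by
  rw [← nhds_prod_eq]
  exact (ContinuousAt.eventually_ne (by fun_prop) (by simpa)).and
    (ContinuousAt.eventually_ne (by fun_prop) (by simpa))

theorem isBigO_dipoleDeriv_line_sub :
    (fun q : (E × E) × ℝ => dipoleDeriv m (q.1.1 + q.2 • q.1.2) q.1.2 +
      dipoleDeriv m (q.1.1 - q.2 • q.1.2) (-q.1.2) - 2 * q.2 * dipoleHessian m q.1.1 q.1.2)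
      =O[𝓝 (z₀, p₀) ×ˢ 𝓝 0] fun q => q.2 ^ 3 := by
  have hdir : Tendsto (fun q : (E × E) × ℝ => ((q.1, (q.1.2, (0 : E))), q.2))
      (𝓝 (z₀, p₀) ×ˢ 𝓝 0) (𝓝 ((z₀, p₀), (p₀, 0)) ×ˢ 𝓝 0) := by
    simp only [← nhds_prod_eq]
    exact Continuous.tendsto' (by fun_prop) _ _ rfl
  have hsecond := (isBigO_symm_second_difference
    (contDiffAt_dipoleHessian m (y := (z₀, p₀)) hz₀) (p₀, 0)).comp_tendsto hdir
  refine isBigO_pow_succ_of_hasDerivAt ?_ (fun q => ?_) hsecond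
  rotate_left
  · simp only [dipoleDeriv, zero_smul, add_zero, sub_zero, inner_neg_right]
    ring
  filter_upwards [eventually_line_ne_zero hz₀ p₀] with ⟨⟨z, p⟩, σ⟩ ⟨hplus, hminus⟩
  have hline (d : E) := hasDerivWithinAt_line z d σ
  simp only [sub_eq_add_neg, ← smul_neg] at hminus ⊢
  have hderiv := ((hasDerivWithinAt_dipoleDeriv (hline p) (hasDerivWithinAt_const _ _ p)
    hplus m).fun_add (hasDerivWithinAt_dipoleDeriv (hline (-p))
      (hasDerivWithinAt_const _ _ (-p)) hminus m)).fun_add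
    ((hasDerivWithinAt_id σ univ).const_mul 2 |>.mul_const (dipoleHessian m z p)).fun_neg
  have heven (x : E) : dipoleHessian m x (-p) = dipoleHessian m x p := by
    simp [dipoleHessian]
  have hzero (x : E) : dipoleDeriv m x 0 = 0 := by simp [dipoleDeriv]
  refine (hasDerivWithinAt_univ.1 hderiv).congr_deriv ?_
  simp [heven, hzero]

end Line

/-- The error of the trapezoidal rule on `[-σ, σ]` for the derivative of
`s ↦ angularMomentum m x / ‖x‖` along the line `x = z + s p`. -/
noncomputable def trapezoidDefect (m z p : Plane) (σ : ℝ) : ℝ :=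
  angularMomentum z p * (σ * (⟪m, z + σ • p⟫ / ‖z + σ • p‖ ^ 3 +
      ⟪m, z - σ • p⟫ / ‖z - σ • p‖ ^ 3)) -
    (angularMomentum m (z + σ • p) / ‖z + σ • p‖ - angularMomentum m (z - σ • p) / ‖z - σ • p‖)

theorem isBigO_trapezoidDefect_sub (m : Plane) {z₀ : Plane} (hz₀ : z₀ ≠ 0) (p₀ : Plane) :
    (fun q : (Plane × Plane) × ℝ => trapezoidDefect m q.1.1 q.1.2 q.2 -
      angularMomentum q.1.1 q.1.2 * (2 * q.2 ^ 3 / 3 * dipoleHessian m q.1.1 q.1.2))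
      =O[𝓝 (z₀, p₀) ×ˢ 𝓝 0] fun q => q.2 ^ 5 := by
  have hl : Tendsto (fun q : (Plane × Plane) × ℝ => angularMomentum q.1.1 q.1.2)
      (𝓝 (z₀, p₀) ×ˢ 𝓝 0) (𝓝 (angularMomentum z₀ p₀)) := by
    rw [← nhds_prod_eq]
    exact Continuous.tendsto' (by unfold angularMomentum; fun_prop) _ _ rfl
  have hderiv' := ((hl.isBigO_one ℝ).mul (isBigO_refl (fun q => q.2) _)).mul
    (isBigO_dipoleDeriv_line_sub m hz₀ p₀)
  refine isBigO_pow_succ_of_hasDerivAt ?_ (fun q => by simp [trapezoidDefect])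
    (hderiv'.congr_right fun q => by ring)
  filter_upwards [eventually_line_ne_zero hz₀ p₀] with ⟨⟨z, p⟩, σ⟩ ⟨hplus, hminus⟩
  have hline (d : Plane) := hasDerivWithinAt_line z d σ
  simp only [trapezoidDefect, sub_eq_add_neg, ← smul_neg] at hminus ⊢
  have hunit := (hasDerivWithinAt_angularMomentum_unit (hline p) hplus m).fun_add
    (hasDerivWithinAt_angularMomentum_unit (hline (-p)) hminus m).fun_neg
  have hdipole := (hasDerivWithinAt_id σ univ).fun_mul
    ((hasDerivWithinAt_dipole (hline p) hplus m).fun_add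
      (hasDerivWithinAt_dipole (hline (-p)) hminus m))
  have hcube := (((hasDerivAt_pow 3 σ).const_mul 2).div_const 3).mul_const (dipoleHessian m z p)
  refine HasDerivAt.congr_deriv (hasDerivWithinAt_univ.1
    (((hdipole.const_mul (angularMomentum z p)).fun_add hunit.fun_neg).fun_add
      (hcube.hasDerivWithinAt.const_mul (angularMomentum z p)).fun_neg)) ?_
  have hmom : angularMomentum (z + σ • p) p = angularMomentum z p ∧
      angularMomentum (z + σ • -p) (-p) = -angularMomentum z p := by
    constructor <;> simp only [angularMomentum, PiLp.add_apply, PiLp.smul_apply, PiLp.neg_apply,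
      smul_eq_mul] <;> ring
  rw [hmom.1, hmom.2]
  simp only [id]
  push_cast
  ring

/-! ### The Störmer-Verlet method as a one-step method -/

theorem pos_succ_eq {h : ℝ} (hh : h ≠ 0) (x : ℕ → Plane) (k : ℕ) :
    x (k + 1) = x k + h • svMomentum h x k + (h ^ 2 / 2) • keplerForce (x k) := by
  rw [svMomentum, smul_sub, smul_inv_smul₀ hh, smul_smul]
  module

theorem IsStormerVerlet.svMomentum_succ {h : ℝ} (hh : h ≠ 0) {x : ℕ → Plane}
    (hx : IsStormerVerlet h x) (k : ℕ) :
    svMomentum h x (k + 1) =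
      svMomentum h x k + (h / 2) • (keplerForce (x k) + keplerForce (x (k + 1))) := by
  have hforce : h • keplerForce (x (k + 1)) =
      h⁻¹ • (x (k + 2) - (2 : ℝ) • x (k + 1) + x k) := by
    rw [← hx k, smul_smul]
    congr 1
    field_simp
  calc svMomentum h x (k + 1) = svMomentum h x k + h⁻¹ • (x (k + 2) - (2 : ℝ) • x (k + 1) + x k) -
        (h / 2) • keplerForce (x (k + 1)) + (h / 2) • keplerForce (x k) := by
        simp only [svMomentum]
        module
    _ = _ := by
        rw [← hforce]
        module

/-- The increment function of the Störmer-Verlet method as a one-step method on phase space; the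
arguments are the step size, the position and the momentum. -/
noncomputable def svIncrement (q : ℝ × Plane × Plane) : Plane × Plane :=
  (q.2.2 + (q.1 / 2) • keplerForce q.2.1, (1 / 2 : ℝ) • (keplerForce q.2.1 +
    keplerForce (q.2.1 + q.1 • q.2.2 + (q.1 ^ 2 / 2) • keplerForce q.2.1)))

/-- The position and momentum halfway through a step of the method, between the two kicks. -/
noncomputable def svMidpoint (q : ℝ × Plane × Plane) : Plane × Plane :=
  (q.2.1 + (q.1 / 2) • (q.2.2 + (q.1 / 2) • keplerForce q.2.1),
    q.2.2 + (q.1 / 2) • keplerForce q.2.1)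

theorem contDiffAt_svMidpoint {s : ℝ} {y : Plane × Plane} (hy : y.1 ≠ 0) {n : WithTop ℕ∞} :
    ContDiffAt ℝ n svMidpoint (s, y) := by
  have hf : ContDiffAt ℝ n (fun q : ℝ × Plane × Plane => keplerForce q.2.1) (s, y) :=
    (contDiffAt_keplerForce hy).fun_comp (s, y) contDiffAt_snd.fst
  unfold svMidpoint
  fun_prop

theorem contDiffAt_svIncrement {y : Plane × Plane} (hy : y.1 ≠ 0) {n : WithTop ℕ∞} :
    ContDiffAt ℝ n svIncrement (0, y) := by
  have hf : ContDiffAt ℝ n (fun q : ℝ × Plane × Plane => keplerForce q.2.1) (0, y) :=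
    (contDiffAt_keplerForce hy).fun_comp (0, y) contDiffAt_snd.fst
  have hf' : ContDiffAt ℝ n (fun q : ℝ × Plane × Plane =>
      keplerForce (q.2.1 + q.1 • q.2.2 + (q.1 ^ 2 / 2) • keplerForce q.2.1)) (0, y) :=
    (contDiffAt_keplerForce (by simpa)).fun_comp (0, y) (by fun_prop)
  unfold svIncrement
  fun_prop

theorem angularMomentum_add_smul_keplerForce (x p : Plane) (r : ℝ) :
    angularMomentum x (p + r • keplerForce x) = angularMomentum x p := by
  rw [angularMomentum_add_right, angularMomentum_smul_right, angularMomentum_keplerForce,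
    angularMomentum_self]
  simp

namespace IsStormerVerlet

variable {h : ℝ} (hh : h ≠ 0) {x : ℕ → Plane} (hx : IsStormerVerlet h x)
include hh hx

theorem phase_succ (k : ℕ) :
    (x (k + 1), svMomentum h x (k + 1)) = (x k, svMomentum h x k) +
      h • svIncrement (h, x k, svMomentum h x k) := by
  rw [hx.svMomentum_succ hh, svIncrement, ← pos_succ_eq hh x k, pos_succ_eq hh x k]
  ext1
  · simp only [Prod.fst_add, Prod.smul_fst]
    module
  · simp only [Prod.snd_add, Prod.smul_snd]
    module

theorem angularMomentum_svLrl_succ_sub (m : Plane) (k : ℕ) :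
    angularMomentum m (svLrl h x (k + 1)) - angularMomentum m (svLrl h x k) =
      trapezoidDefect m (svMidpoint (h, x k, svMomentum h x k)).1
        (svMidpoint (h, x k, svMomentum h x k)).2 (h / 2) := by
  generalize hzp : svMidpoint (h, x k, svMomentum h x k) = y
  obtain ⟨z, p⟩ := y
  obtain ⟨hz, hp⟩ := Prod.ext_iff.1 hzp
  simp only [svMidpoint] at hz hp
  have hstart : z - (h / 2) • p = x k := by
    rw [← hz, ← hp]
    module
  have hend : z + (h / 2) • p = x (k + 1) := by
    rw [← hz, ← hp, pos_succ_eq hh x k]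
    module
  have hmomStart : svMomentum h x k = p + (-(h / 2)) • keplerForce (x k) := by
    rw [← hp]
    module
  have hmomEnd : svMomentum h x (k + 1) = p + (h / 2) • keplerForce (x (k + 1)) := by
    rw [hx.svMomentum_succ hh, ← hp]
    module
  have hdrift (r : ℝ) : angularMomentum (z + r • p) p = angularMomentum z p := by
    rw [angularMomentum_add_left, angularMomentum_smul_left, angularMomentum_self]
    ring
  have hlStart : angularMomentum (x k) p = angularMomentum z p := by
    rw [← hstart, sub_eq_add_neg, ← neg_smul, hdrift]
  have hlEnd : angularMomentum (x (k + 1)) p = angularMomentum z p := by rw [← hend, hdrift]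
  rw [svLrl, svLrl, angularMomentum_lrlVector, angularMomentum_lrlVector, hmomEnd, hmomStart,
    angularMomentum_add_smul_keplerForce, angularMomentum_add_smul_keplerForce, hlStart, hlEnd,
    trapezoidDefect, hstart, hend, inner_add_right, inner_add_right, real_inner_smul_right,
    real_inner_smul_right, inner_keplerForce, inner_keplerForce]
  ring

end IsStormerVerlet

/-! ### Precession of the Störmer-Verlet method -/

theorem contDiff_angularMomentum {n : WithTop ℕ∞} :
    ContDiff ℝ n fun y : Plane × Plane => angularMomentum y.1 y.2 := by
  have hcoord (i : Fin 2) : ContDiff ℝ n fun x : Plane => x i :=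
    (EuclideanSpace.proj (𝕜 := ℝ) i).contDiff
  unfold angularMomentum
  exact (((hcoord 0).comp contDiff_fst).mul ((hcoord 1).comp contDiff_snd)).sub
    (((hcoord 0).comp contDiff_snd).mul ((hcoord 1).comp contDiff_fst))

theorem contDiffAt_lrlVector {y : Plane × Plane} (hy : y.1 ≠ 0) {n : WithTop ℕ∞} :
    ContDiffAt ℝ n (fun y : Plane × Plane => lrlVector y.1 y.2) y := by
  have hinv : ContDiffAt ℝ n (fun y : Plane × Plane => ‖y.1‖⁻¹) y :=
    (contDiffAt_fst.norm ℝ hy).inv (norm_ne_zero_iff.2 hy)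
  exact (((contDiffAt_snd.norm_sq ℝ).smul contDiffAt_fst).sub
    ((contDiffAt_fst.inner ℝ contDiffAt_snd).smul contDiffAt_snd)).sub (hinv.smul contDiffAt_fst)

namespace IsKeplerSolution

variable {X V : ℝ → Plane} (hX : IsKeplerSolution X V)
include hX

theorem contDiff_vel {n : ℕ} : ContDiff ℝ n V := contDiff_snd.comp hX.contDiff_phase

theorem contDiff_keplerForce {n : ℕ} : ContDiff ℝ n fun t => keplerForce (X t) :=
  contDiff_iff_contDiffAt.2 fun t => (contDiffAt_keplerForce (hX.ne_zero t)).fun_comp t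
    (contDiff_fst.comp hX.contDiff_phase).contDiffAt

theorem contDiff_dipoleHessian (m : Plane) {n : ℕ} :
    ContDiff ℝ n fun t => dipoleHessian m (X t) (V t) :=
  contDiff_iff_contDiffAt.2 fun t => ContDiffAt.fun_comp (f := fun t => (X t, V t)) t
    (contDiffAt_dipoleHessian m (hX.ne_zero t)) hX.contDiff_phase.contDiffAt

theorem isCompact_phase (T : ℝ) : IsCompact ((fun t => (X t, V t)) '' Icc 0 T) :=
  isCompact_Icc.image (hX.contDiff_phase (n := 0)).continuous

theorem isBigO_svIncrement_local (t₀ : ℝ) :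
    (fun q : ℝ × ℝ => (X (q.1 + q.2), V (q.1 + q.2)) -
      ((X q.1, V q.1) + q.2 • svIncrement (q.2, X q.1, V q.1))) =O[𝓝 t₀ ×ˢ 𝓝 0]
      fun q => q.2 ^ 3 := by
  have hpos := isBigO_taylor_three t₀ hX.hasDerivAt_pos hX.hasDerivAt_vel
    (hX.contDiff_keplerForce (n := 1))
  have hmom := isBigO_trapezoid t₀ hX.hasDerivAt_vel (hX.contDiff_keplerForce (n := 2))
  set X₁ : ℝ × ℝ → Plane := fun q => X q.1 + q.2 • V q.1 + (q.2 ^ 2 / 2) • keplerForce (X q.1)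
  have hend : Tendsto (fun q : ℝ × ℝ => X (q.1 + q.2)) (𝓝 t₀ ×ˢ 𝓝 0) (𝓝 (X t₀)) :=
    hX.continuous_pos.continuousAt.tendsto.comp (tendsto_add_nhds_zero t₀)
  have hX₁ : Tendsto X₁ (𝓝 t₀ ×ˢ 𝓝 0) (𝓝 (X t₀)) := by
    have hXc := hX.continuous_pos
    have hVc : Continuous V := (hX.contDiff_vel (n := 0)).continuous
    have hfc : Continuous fun q : ℝ × ℝ => keplerForce (X q.1) :=
      (hX.contDiff_keplerForce (n := 0)).continuous.comp continuous_fst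
    rw [← nhds_prod_eq]
    refine Continuous.tendsto' ?_ _ _ (by simp [X₁])
    exact (by fun_prop : Continuous fun q : ℝ × ℝ => X q.1 + q.2 • V q.1).add
      (Continuous.smul (f := fun q : ℝ × ℝ => q.2 ^ 2 / 2) (by fun_prop) hfc)
  have hforce : (fun q : ℝ × ℝ => keplerForce (X (q.1 + q.2)) - keplerForce (X₁ q))
      =O[𝓝 t₀ ×ˢ 𝓝 0] fun q => q.2 ^ 3 := by
    refine ((((contDiffAt_keplerForce (n := 1) (hX.ne_zero t₀)).hasStrictFDerivAt
      one_ne_zero).isBigO_sub).comp_tendsto (hend.prodMk_nhds hX₁)).trans (hpos.congr_left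
        fun q => ?_)
    simp only [Function.comp_apply, X₁]
    module
  have hkick : (fun q : ℝ × ℝ => (q.2 / 2) • (keplerForce (X (q.1 + q.2)) - keplerForce (X₁ q)))
      =O[𝓝 t₀ ×ˢ 𝓝 0] fun q => q.2 ^ 3 := by
    have hone : (fun q : ℝ × ℝ => q.2 / 2) =O[𝓝 t₀ ×ˢ 𝓝 0] fun _ => (1 : ℝ) :=
      (tendsto_snd.div_const 2).isBigO_one ℝ
    simpa using hone.smul hforce
  refine (hpos.prod_left (hmom.add hkick)).congr_left fun q => ?_
  ext1 <;> simp only [svIncrement, X₁, Prod.fst_sub, Prod.fst_add, Prod.smul_fst, Prod.snd_sub,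
    Prod.snd_add, Prod.smul_snd] <;> module

theorem isBigO_svMidpoint_local (t₀ : ℝ) :
    (fun q : ℝ × ℝ => svMidpoint (q.2, X q.1, V q.1) - (X (q.1 + q.2 / 2), V (q.1 + q.2 / 2)))
      =O[𝓝 t₀ ×ˢ 𝓝 0] fun q => q.2 ^ 2 := by
  have hhalf : Tendsto (fun q : ℝ × ℝ => (q.1, q.2 / 2)) (𝓝 t₀ ×ˢ 𝓝 0) (𝓝 t₀ ×ˢ 𝓝 0) := by
    simp only [← nhds_prod_eq]
    exact Continuous.tendsto' (by fun_prop) _ _ (by simp)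
  have hsq : (fun q : ℝ × ℝ => (q.2 / 2) ^ 2) =O[𝓝 t₀ ×ˢ 𝓝 0] fun q => q.2 ^ 2 := by
    simpa only [div_eq_inv_mul] using
      ((isBigO_refl (fun q : ℝ × ℝ => q.2) (𝓝 t₀ ×ˢ 𝓝 0)).const_mul_left 2⁻¹).pow 2
  have hpos := (isBigO_taylor_two t₀ hX.hasDerivAt_pos (hX.contDiff_vel (n := 1))).comp_tendsto
    hhalf |>.trans hsq
  have hmom := (isBigO_taylor_two t₀ hX.hasDerivAt_vel
    (hX.contDiff_keplerForce (n := 1))).comp_tendsto hhalf |>.trans hsq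
  have hforce : (fun q : ℝ × ℝ => keplerForce (X q.1)) =O[𝓝 t₀ ×ˢ 𝓝 0] fun _ => (1 : ℝ) :=
    ((hX.contDiff_keplerForce (n := 0)).continuous.continuousAt.tendsto.comp
      tendsto_fst).isBigO_one ℝ
  have hkick : (fun q : ℝ × ℝ => (q.2 / 2) ^ 2 • keplerForce (X q.1)) =O[𝓝 t₀ ×ˢ 𝓝 0]
      fun q => q.2 ^ 2 := by
    simpa using hsq.smul hforce
  refine ((hkick.sub hpos).prod_left hmom.neg_left).congr_left fun q => ?_
  ext1 <;> simp only [svMidpoint, Function.comp_apply, Prod.fst_sub, Prod.snd_sub] <;> module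

end IsKeplerSolution

section Interpolation

variable {ι : Type*} {l : Filter ι} {h : ι → ℝ} {T : ℝ}

theorem floor_div_mul_le {s : ℝ} (hT : 0 ≤ T) (hs : 0 < s) : ⌊T / s⌋₊ * s ≤ T :=
  (le_div_iff₀ hs).1 (Nat.floor_le (div_nonneg hT hs.le))

variable (hT : 0 ≤ T) (hh : Tendsto h l (𝓝[>] 0))
include hT hh

theorem isBigO_div_sub_floor :
    (fun i => T / h i - ⌊T / h i⌋₊) =O[l] fun _ => (1 : ℝ) := by
  refine .of_bound 1 ?_
  filter_upwards [hh.eventually self_mem_nhdsWithin] with i hi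
  have hdiv : 0 ≤ T / h i := div_nonneg hT (le_of_lt hi)
  rw [norm_one, one_mul, Real.norm_of_nonneg (sub_nonneg.2 (Nat.floor_le hdiv)),
    sub_le_iff_le_add']
  exact (Nat.lt_floor_add_one _).le

theorem isBigO_interpolate_sub {W W' : ℝ → ℝ} (hW : ∀ t, HasDerivAt W (W' t) t)
    (hW' : ContDiff ℝ 1 W') :
    (fun i => W (⌊T / h i⌋₊ * h i) + (T / h i - ⌊T / h i⌋₊) *
      (W ((⌊T / h i⌋₊ + 1) * h i) - W (⌊T / h i⌋₊ * h i)) - W T) =O[l] fun i => h i ^ 2 := by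
  have hfrac := isBigO_div_sub_floor hT hh
  have htaylor (c : ℝ) : (fun i => W ((⌊T / h i⌋₊ + c) * h i) - W T -
      ((⌊T / h i⌋₊ + c) * h i - T) * W' T) =O[l] fun i => h i ^ 2 := by
    have hstep : (fun i => (⌊T / h i⌋₊ + c) * h i - T) =O[l] h := by
      refine (((isBigO_const_const c one_ne_zero l).sub hfrac).mul (isBigO_refl h l)).congr' ?_
        (.of_forall fun i => one_mul _)
      filter_upwards [hh.eventually self_mem_nhdsWithin] with i hi
      have := ne_of_gt hi
      field_simp
      ring
    have hcomp := (isBigO_taylor_two T hW hW').comp_tendsto ((tendsto_const_nhds (x := T)).prodMk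
      (hstep.trans_tendsto (hh.mono_right nhdsWithin_le_nhds)))
    refine (hcomp.trans (hstep.pow 2)).congr_left fun i => ?_
    simp [Function.comp_apply]
  refine ((htaylor 0).add ((hfrac.mul ((htaylor 1).sub (htaylor 0))).congr_right
    fun i => one_mul _)).congr' ?_ .rfl
  filter_upwards [hh.eventually self_mem_nhdsWithin] with i hi
  have hcancel : T / h i * h i = T := div_mul_cancel₀ T (ne_of_gt hi)
  simp only [add_zero]
  linear_combination -W' T * hcancel

end Interpolation

section Convergence

variable {ι : Type*} {l : Filter ι} {h : ι → ℝ} {x : ι → ℕ → Plane} {X V : ℝ → Plane}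

theorem tendsto_step_gridFilter {T : ℝ} (hh : Tendsto h l (𝓝[>] 0)) :
    Tendsto (fun q => h q.1) (gridFilter l h T) (𝓝 0) :=
  (hh.mono_right nhdsWithin_le_nhds).comp tendsto_fst_gridFilter

theorem tendsto_step_pow_gridFilter {T : ℝ} (hh : Tendsto h l (𝓝[>] 0)) {n : ℕ} (hn : n ≠ 0) :
    Tendsto (fun q => h q.1 ^ n) (gridFilter l h T) (𝓝 0) := by
  simpa [hn] using (tendsto_step_gridFilter hh).pow n

theorem eventually_mid_mem_Icc {T : ℝ} (hh : Tendsto h l (𝓝[>] 0)) :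
    ∀ᶠ q in gridFilter l h T, q.2 * h q.1 + h q.1 / 2 ∈ Icc 0 (T + 1) := by
  have hpos := hh.eventually self_mem_nhdsWithin
  filter_upwards [eventually_gridFilter_mem_Icc hpos, tendsto_fst_gridFilter.eventually hpos,
    (tendsto_step_gridFilter hh).eventually_lt_const one_pos] with q hq hq0 hq1
  exact ⟨by linarith [hq.1], by linarith [hq.2]⟩

variable (hX : IsKeplerSolution X V) (hh : Tendsto h l (𝓝[>] 0))
  (hx : ∀ᶠ i in l, IsStormerVerlet (h i) (x i))
  (hz₀ : (fun i => (x i 0, svMomentum (h i) (x i) 0) - (X 0, V 0)) =O[l] fun i => h i ^ 2) (T : ℝ)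
include hX hh hx hz₀

theorem isBigO_sv_sub :
    (fun q => (x q.1 q.2, svMomentum (h q.1) (x q.1) q.2) - (X (q.2 * h q.1), V (q.2 * h q.1)))
      =O[gridFilter l h T] fun q => h q.1 ^ 2 := by
  refine isBigO_oneStep_sub (Y := fun t => (X t, V t)) (Ψ := svIncrement)
    (z := fun i k => (x i k, svMomentum (h i) (x i) k))
    (hX.contDiff_phase (n := 0)).continuous.continuousOn
    (fun t _ => contDiffAt_svIncrement (hX.ne_zero t)) two_ne_zero
    (fun t _ => hX.isBigO_svIncrement_local t) hh hz₀ ?_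
  filter_upwards [hx, hh.eventually self_mem_nhdsWithin] with i hi hpos
  exact hi.phase_succ (ne_of_gt hpos)

theorem isBigO_svMidpoint_sub :
    (fun q => svMidpoint (h q.1, x q.1 q.2, svMomentum (h q.1) (x q.1) q.2) -
        (X (q.2 * h q.1 + h q.1 / 2), V (q.2 * h q.1 + h q.1 / 2)))
      =O[gridFilter l h T] fun q => h q.1 ^ 2 := by
  have hstate := isBigO_sv_sub hX hh hx hz₀ T
  have hstep := tendsto_step_gridFilter (T := T) hh
  have hlip := isBigO_comp_sub_comp (g := svMidpoint) (l := gridFilter l h T)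
    (K := {0} ×ˢ ((fun t => (X t, V t)) '' Icc 0 T))
    (y := fun q => (0, X (q.2 * h q.1), V (q.2 * h q.1)))
    (z := fun q => (h q.1, x q.1 q.2, svMomentum (h q.1) (x q.1) q.2))
    (w := fun q => (h q.1, X (q.2 * h q.1), V (q.2 * h q.1)))
    (isCompact_singleton.prod (hX.isCompact_phase T)) ?_ ?_ ?_ ?_
  · refine ((hlip.trans ?_).add (isBigO_gridFilter_of_forall hh fun t _ =>
      hX.isBigO_svMidpoint_local t)).congr_left fun q => by simp
    simpa using (isBigO_zero _ _).prod_left hstate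
  · rintro ⟨s, _⟩ ⟨-, t, -, rfl⟩
    exact contDiffAt_svMidpoint (hX.ne_zero t)
  · filter_upwards [eventually_gridFilter_mem_Icc (hh.eventually self_mem_nhdsWithin)] with q hq
    exact ⟨rfl, mem_image_of_mem _ hq⟩
  · simpa [Prod.zero_eq_mk] using hstep.prodMk_nhds
      (hstate.trans_tendsto (tendsto_step_pow_gridFilter hh two_ne_zero))
  · simpa [Prod.zero_eq_mk] using hstep.prodMk_nhds
      (tendsto_const_nhds (x := (0 : Plane × Plane)))

theorem isBigO_angularMomentum_svLrl_succ_sub_midpoint (m : Plane) :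
    (fun q => angularMomentum m (svLrl (h q.1) (x q.1) (q.2 + 1)) -
        angularMomentum m (svLrl (h q.1) (x q.1) q.2) - h q.1 ^ 3 / 12 *
          (fun y : Plane × Plane => angularMomentum y.1 y.2 * dipoleHessian m y.1 y.2)
            (svMidpoint (h q.1, x q.1 q.2, svMomentum (h q.1) (x q.1) q.2)))
      =O[gridFilter l h T] fun q => h q.1 ^ 5 := by
  set Y := fun q : ι × ℕ => (X (q.2 * h q.1 + h q.1 / 2), V (q.2 * h q.1 + h q.1 / 2))
  have hK := (hX.isCompact_phase (T + 1)).prod (isCompact_singleton (x := (0 : ℝ)))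
  have hmid := (isBigO_svMidpoint_sub hX hh hx hz₀ T).trans_tendsto
    (tendsto_step_pow_gridFilter hh two_ne_zero)
  have hhalf : Tendsto (fun q => h q.1 / 2) (gridFilter l h T) (𝓝 0) := by
    simpa using (tendsto_step_gridFilter hh).div_const 2
  have hlocal : ∀ y ∈ ((fun t => (X t, V t)) '' Icc 0 (T + 1)) ×ˢ {(0 : ℝ)},
      (fun q : (Plane × Plane) × ℝ => trapezoidDefect m q.1.1 q.1.2 q.2 -
        angularMomentum q.1.1 q.1.2 * (2 * q.2 ^ 3 / 3 * dipoleHessian m q.1.1 q.1.2))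
        =O[𝓝 y] fun q => q.2 ^ 5 := by
    rintro ⟨_, s⟩ ⟨⟨t, -, rfl⟩, rfl⟩
    rw [nhds_prod_eq]
    exact isBigO_trapezoidDefect_sub m (hX.ne_zero t) (V t)
  have hdefect := (isBigO_nhdsSet_of_forall hK hlocal).comp_tendsto
    (tendsto_nhdsSet_of_tendsto_sub (y := fun q => (Y q, (0 : ℝ))) hK
      ((eventually_mid_mem_Icc hh).mono fun q hq => ⟨mem_image_of_mem _ hq, rfl⟩)
      (z := fun q => (svMidpoint (h q.1, x q.1 q.2, svMomentum (h q.1) (x q.1) q.2), h q.1 / 2))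
      (by simpa [Prod.zero_eq_mk] using hmid.prodMk_nhds hhalf))
  have hpow : (fun q : ι × ℕ => (h q.1 / 2) ^ 5) =O[gridFilter l h T] fun q => h q.1 ^ 5 := by
    simpa only [div_eq_inv_mul] using
      ((isBigO_refl (fun q : ι × ℕ => h q.1) (gridFilter l h T)).const_mul_left 2⁻¹).pow 5
  refine (hdefect.trans hpow).congr' ?_ .rfl
  filter_upwards [tendsto_fst_gridFilter.eventually hx,
    tendsto_fst_gridFilter.eventually (hh.eventually self_mem_nhdsWithin)] with q hq hpos
  rw [hq.angularMomentum_svLrl_succ_sub (ne_of_gt hpos), Function.comp_apply]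
  ring

theorem isBigO_angularMomentum_svLrl_succ_sub (m : Plane) :
    (fun q => angularMomentum m (svLrl (h q.1) (x q.1) (q.2 + 1)) -
        angularMomentum m (svLrl (h q.1) (x q.1) q.2) -
        h q.1 ^ 3 / 12 * (angularMomentum (X 0) (V 0) *
          dipoleHessian m (X (q.2 * h q.1 + h q.1 / 2)) (V (q.2 * h q.1 + h q.1 / 2))))
      =O[gridFilter l h T] fun q => h q.1 ^ 5 := by
  have hmid := isBigO_svMidpoint_sub hX hh hx hz₀ T
  have hdrift := isBigO_comp_sub_comp
    (g := fun y : Plane × Plane => angularMomentum y.1 y.2 * dipoleHessian m y.1 y.2)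
    (hX.isCompact_phase (T + 1))
    (by
      rintro _ ⟨t, -, rfl⟩
      exact contDiff_angularMomentum.contDiffAt.mul (contDiffAt_dipoleHessian m (hX.ne_zero t)))
    ((eventually_mid_mem_Icc hh).mono fun q hq => mem_image_of_mem _ hq)
    (hmid.trans_tendsto (tendsto_step_pow_gridFilter hh two_ne_zero))
    (by simpa only [sub_self] using tendsto_const_nhds) |>.trans hmid
  have hcube := ((isBigO_refl (fun q : ι × ℕ => h q.1 ^ 3) (gridFilter l h T)).const_mul_left
    12⁻¹).mul hdrift
  refine ((isBigO_angularMomentum_svLrl_succ_sub_midpoint hX hh hx hz₀ T m).add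
    (hcube.congr_right (g₂ := fun q => h q.1 ^ 5) fun q => by ring)).congr_left fun q => ?_
  rw [hX.angularMomentum_eq]
  ring

theorem isBigO_angularMomentum_svLrl_sub {m : Plane} {W : ℝ → ℝ}
    (hW : ∀ t, HasDerivAt W (dipoleHessian m (X t) (V t)) t) :
    (fun q => angularMomentum m (svLrl (h q.1) (x q.1) q.2) -
        angularMomentum m (svLrl (h q.1) (x q.1) 0) -
        h q.1 ^ 2 * (angularMomentum (X 0) (V 0) / 12) * (W (q.2 * h q.1) - W 0))
      =O[gridFilter l h T] fun q => h q.1 ^ 4 := by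
  have hmidpoint := isBigO_gridFilter_of_forall (T := T) (f := fun q : ℝ × ℝ => W (q.1 + q.2) -
    W q.1 - q.2 • dipoleHessian m (X (q.1 + q.2 / 2)) (V (q.1 + q.2 / 2))) hh
    fun t _ => isBigO_midpoint t hW (hX.contDiff_dipoleHessian m)
  have hscale := ((isBigO_refl (fun q : ι × ℕ => h q.1 ^ 2) (gridFilter l h T)).const_mul_left
    (angularMomentum (X 0) (V 0) / 12)).mul hmidpoint
  refine (isBigO_gridFilter_sub_zero (r := fun i k => angularMomentum m (svLrl (h i) (x i) k) -
    h i ^ 2 * (angularMomentum (X 0) (V 0) / 12) * W (k * h i))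
    (hh.eventually self_mem_nhdsWithin) ?_).congr_left fun q => ?_
  · refine ((isBigO_angularMomentum_svLrl_succ_sub hX hh hx hz₀ T m).sub
      (hscale.congr_right (g₂ := fun q => h q.1 ^ 5) fun q => by ring)).congr_left fun q => ?_
    rw [show ((q.2 + 1 : ℕ) : ℝ) * h q.1 = q.2 * h q.1 + h q.1 by push_cast; ring, smul_eq_mul]
    ring
  · rw [Nat.cast_zero, zero_mul]
    ring

theorem isBigO_svLrl_sub :
    (fun q => svLrl (h q.1) (x q.1) q.2 - lrlVector (X 0) (V 0))
      =O[gridFilter l h T] fun q => h q.1 ^ 2 := by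
  have hstate := isBigO_sv_sub hX hh hx hz₀ T
  have hlip := isBigO_comp_sub_comp (g := fun y : Plane × Plane => lrlVector y.1 y.2)
    (hX.isCompact_phase T)
    (by rintro _ ⟨t, -, rfl⟩; exact contDiffAt_lrlVector (hX.ne_zero t))
    ((eventually_gridFilter_mem_Icc (hh.eventually self_mem_nhdsWithin)).mono fun q hq =>
      mem_image_of_mem _ hq)
    (hstate.trans_tendsto (tendsto_step_pow_gridFilter hh two_ne_zero))
    (w := fun q => (X (q.2 * h q.1), V (q.2 * h q.1)))
    (by simpa only [sub_self] using tendsto_const_nhds)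
  exact (hlip.trans hstate).congr_left fun q => by rw [hX.lrlVector_eq, svLrl]

variable {T} (hm : lrlVector (X 0) (V 0) ≠ 0)
include hm

theorem eventually_svAngle_eq :
    ∀ᶠ q in gridFilter l h T, svAngle (h q.1) (x q.1) q.2 =
      signedAngle (lrlVector (X 0) (V 0)) (svLrl (h q.1) (x q.1) q.2) -
        signedAngle (lrlVector (X 0) (V 0)) (svLrl (h q.1) (x q.1) 0) := by
  have hnear := ((isBigO_svLrl_sub hX hh hx hz₀ T).trans_tendsto
    (tendsto_step_pow_gridFilter hh two_ne_zero)).norm.eventually_lt_const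
      (by simpa using hm : ‖(0 : Plane)‖ < ‖lrlVector (X 0) (V 0)‖)
  rw [eventually_gridFilter] at hnear ⊢
  filter_upwards [hnear, hh.eventually self_mem_nhdsWithin] with i hi hpos n hn
  have hle {k : ℕ} (hk : k ≤ n) : k * h i ≤ T := le_trans (by gcongr) hn
  rw [svAngle, ← Finset.sum_range_sub fun k =>
    signedAngle (lrlVector (X 0) (V 0)) (svLrl (h i) (x i) k)]
  refine Finset.sum_congr rfl fun k hk => ?_
  have hkn := Finset.mem_range.1 hk
  exact signedAngle_eq_sub (hi k (hle hkn.le)) (hi (k + 1) (hle hkn))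

theorem isBigO_svAngle_sub (hT : 0 ≤ T) {W : ℝ → ℝ}
    (hW : ∀ t, HasDerivAt W (dipoleHessian (lrlVector (X 0) (V 0)) (X t) (V t)) t) :
    (fun q => svAngle (h q.1) (x q.1) q.2 - h q.1 ^ 2 * (angularMomentum (X 0) (V 0) / 12) *
        (W (q.2 * h q.1) - W 0) / ‖lrlVector (X 0) (V 0)‖ ^ 2)
      =O[gridFilter l h T] fun q => h q.1 ^ 4 := by
  have hangle := (isBigO_signedAngle_sub hm (isBigO_svLrl_sub hX hh hx hz₀ T)
    (tendsto_step_pow_gridFilter hh two_ne_zero)).congr_right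
      (g₂ := fun q => h q.1 ^ 4) fun q => by ring
  have hstart : Tendsto (fun q : ι × ℕ => (q.1, 0)) (gridFilter l h T) (gridFilter l h T) :=
    (tendsto_gridFilter (n := fun _ => 0) (by simpa using .of_forall fun _ => hT)).comp
      tendsto_fst_gridFilter
  have hdrift := (isBigO_angularMomentum_svLrl_sub hX hh hx hz₀ T hW).const_mul_left
    (‖lrlVector (X 0) (V 0)‖ ^ 2)⁻¹
  refine ((hangle.sub (hangle.comp_tendsto (k := fun q : ι × ℕ => (q.1, 0)) hstart)).add
    hdrift).congr' ?_ .rfl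
  filter_upwards [eventually_svAngle_eq hX hh hx hz₀ hm] with q hq
  rw [hq, Function.comp_apply]
  ring

theorem isBigO_svPrecession_sub (hT : 0 ≤ T) {W : ℝ → ℝ}
    (hW : ∀ t, HasDerivAt W (dipoleHessian (lrlVector (X 0) (V 0)) (X t) (V t)) t) :
    (fun i => svPrecession (h i) (x i) T -
        h i ^ 2 * (angularMomentum (X 0) (V 0) / 12 * (W T - W 0) / ‖lrlVector (X 0) (V 0)‖ ^ 2))
      =O[l] fun i => h i ^ 4 := by
  have hgrid (j : ℕ) (hj : j ≤ 1) :
      Tendsto (fun i => (i, ⌊T / h i⌋₊ + j)) l (gridFilter l h (T + 1)) := by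
    refine tendsto_gridFilter (n := fun i => ⌊T / h i⌋₊ + j) ?_
    filter_upwards [hh.eventually self_mem_nhdsWithin,
      (hh.mono_right nhdsWithin_le_nhds).eventually_lt_const one_pos] with i hi hi1
    have hj' : (j : ℝ) ≤ 1 := by exact_mod_cast hj
    push_cast
    nlinarith [floor_div_mul_le hT hi, mul_le_mul_of_nonneg_right hj' (le_of_lt hi)]
  have hangle := isBigO_svAngle_sub hX hh hx hz₀ (T := T + 1) hm (by linarith) hW
  have h₀ := hangle.comp_tendsto (hgrid 0 zero_le_one)
  have h₁ := hangle.comp_tendsto (hgrid 1 le_rfl)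
  have hfrac : (fun i => T / h i - ⌊T / h i⌋₊) =O[l] fun _ => (1 : ℝ) :=
    isBigO_div_sub_floor hT hh
  have hangles := h₀.add ((hfrac.mul (h₁.sub h₀)).congr_right fun i => one_mul _)
  have hinterp := ((isBigO_refl (fun i => h i ^ 2) l).const_mul_left
    (angularMomentum (X 0) (V 0) / 12 / ‖lrlVector (X 0) (V 0)‖ ^ 2)).mul
      (isBigO_interpolate_sub hT hh hW (hX.contDiff_dipoleHessian _))
  refine (hangles.add (hinterp.congr_right (g₂ := fun i => h i ^ 4) fun i => by ring)).congr_left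
    fun i => ?_
  simp only [Function.comp_apply, svPrecession, add_zero, Nat.cast_add, Nat.cast_one]
  ring

end Convergence

/-! ### Perturbed differential equations -/

theorem le_of_continuousOn_of_forall_lt_imp_le {d : ℝ → ℝ} {T δ ε : ℝ}
    (hd : ContinuousOn d (Icc 0 T)) (hεδ : ε < δ) (h0 : d 0 < δ)
    (hstep : ∀ t ∈ Icc 0 T, (∀ s ∈ Icc 0 t, d s < δ) → d t ≤ ε) : ∀ t ∈ Icc 0 T, d t ≤ ε := by
  obtain ⟨c, hεc, hcδ⟩ := exists_between hεδ
  suffices hlt : ∀ t ∈ Icc 0 T, d t < c from fun t ht =>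
    hstep t ht fun s hs => (hlt s ⟨hs.1, hs.2.trans ht.2⟩).trans hcδ
  by_contra! hexit
  have hcompact : IsCompact (Icc 0 T ∩ d ⁻¹' Ici c) :=
    isCompact_Icc.of_isClosed_subset (hd.preimage_isClosed_of_isClosed isClosed_Icc isClosed_Ici)
      inter_subset_left
  obtain ⟨t, ⟨ht, hct⟩, hmin⟩ := hcompact.exists_isLeast hexit
  have hstart : d 0 ≤ ε := hstep 0 ⟨le_rfl, ht.1.trans ht.2⟩ fun s hs => by
    rwa [le_antisymm hs.2 hs.1]
  obtain ⟨s, hs, hsc⟩ := intermediate_value_Icc ht.1 (hd.mono (Icc_subset_Icc_right ht.2))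
    ⟨hstart.trans hεc.le, hct⟩
  have hst : s = t := le_antisymm hs.2 (hmin ⟨⟨hs.1, hs.2.trans ht.2⟩, hsc.ge⟩)
  have hbefore : ∀ r ∈ Icc 0 t, d r < δ := fun r hr => by
    rcases hr.2.eq_or_lt with rfl | hrt
    · rwa [← hst, hsc]
    · by_contra! hδr
      exact hrt.not_ge (hmin ⟨⟨hr.1, hr.2.trans ht.2⟩, hcδ.le.trans hδr⟩)
  exact hεc.not_ge (hct.trans (hstep t ht hbefore))

theorem gronwallBound_mul (δ K ε c t : ℝ) :
    gronwallBound (δ * c) K (ε * c) t = gronwallBound δ K ε t * c := by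
  unfold gronwallBound
  split_ifs <;> ring

theorem exists_norm_le_near_orbit {E E' : Type*} [SeminormedAddCommGroup E]
    [SeminormedAddCommGroup E'] {Y : ℝ → E} {H : E → E'} {T : ℝ} (hY : ContinuousOn Y (Icc 0 T))
    (hH : ∀ t ∈ Icc 0 T, ContinuousAt H (Y t)) :
    ∃ Q ≥ 0, ∃ δ > 0, ∀ t ∈ Icc 0 T, ∀ z, ‖z - Y t‖ < δ → ‖H z‖ ≤ Q := by
  have hK := isCompact_Icc.image_of_continuousOn hY
  obtain ⟨Q, hQ0, hQ⟩ := (isBigO_nhdsSet_of_forall (g := fun _ => (1 : ℝ)) hK (by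
    rintro _ ⟨t, ht, rfl⟩
    exact (hH t ht).isBigO_one ℝ)).exists_nonneg
  obtain ⟨δ, hδ, hδQ⟩ := (Metric.hasBasis_nhdsSet_thickening hK).mem_iff.1 hQ.bound
  refine ⟨Q, hQ0, δ, hδ, fun t ht z hz => ?_⟩
  simpa using hδQ (Metric.mem_thickening_iff.2 ⟨Y t, mem_image_of_mem Y ht, by rwa [dist_eq_norm]⟩)

section Perturbation

variable {E : Type*} [NormedAddCommGroup E] [NormedSpace ℝ E]

theorem norm_sub_le_gronwallBound_of_perturbation {Y Y' z f ζ ζ' : ℝ → E} {D M Q e t : ℝ}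
    (hM : 0 ≤ M) (ht : 0 ≤ t) (hY : ∀ s ∈ Icc 0 t, HasDerivWithinAt Y (Y' s) (Icc 0 t) s)
    (hζ : ∀ s ∈ Icc 0 t, HasDerivWithinAt ζ (ζ' s) (Icc 0 t) s)
    (hf : ∀ s ∈ Icc 0 t, ‖f s - Y' s‖ ≤ M * ‖z s - Y s‖)
    (hζz : ∀ s ∈ Icc 0 t, ‖ζ s - z s‖ ≤ Q * e) (hζf : ∀ s ∈ Icc 0 t, ‖ζ' s - f s‖ ≤ Q * e)
    (h0 : ‖z 0 - Y 0‖ ≤ D * e) :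
    ‖z t - Y t‖ ≤ (gronwallBound (D + Q) M ((M + 1) * Q) t + Q) * e := by
  have hgronwall := norm_le_gronwallBound_of_norm_deriv_right_le (f := fun s => ζ s - Y s)
    (f' := fun s => ζ' s - Y' s) (δ := (D + Q) * e) (K := M) (ε := (M + 1) * Q * e) (a := 0)
    (b := t) (fun s hs => ((hζ s hs).fun_sub (hY s hs)).continuousWithinAt) (fun s hs => ?_) ?_
    (fun s hs => ?_) t ⟨ht, le_rfl⟩
  · rw [gronwallBound_mul, sub_zero] at hgronwall
    calc ‖z t - Y t‖ = ‖(ζ t - Y t) - (ζ t - z t)‖ := by congr 1; abel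
      _ ≤ _ := norm_sub_le_of_le hgronwall (hζz t ⟨ht, le_rfl⟩)
      _ = _ := by ring
  · exact ((hζ s ⟨hs.1, hs.2.le⟩).fun_sub (hY s ⟨hs.1, hs.2.le⟩)).mono_of_mem_nhdsWithin
      (Icc_mem_nhdsGE_of_mem hs)
  · calc ‖ζ 0 - Y 0‖ = ‖(z 0 - Y 0) + (ζ 0 - z 0)‖ := by congr 1; abel
      _ ≤ D * e + Q * e := norm_add_le_of_le h0 (hζz 0 ⟨le_rfl, ht⟩)
      _ = _ := by ring
  · have hs' : s ∈ Icc 0 t := ⟨hs.1, hs.2.le⟩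
    have hz : ‖z s - Y s‖ ≤ ‖ζ s - Y s‖ + Q * e := by
      rw [show z s - Y s = (ζ s - Y s) - (ζ s - z s) by abel]
      exact norm_sub_le_of_le le_rfl (hζz s hs')
    calc ‖ζ' s - Y' s‖ = ‖(ζ' s - f s) + (f s - Y' s)‖ := by congr 1; abel
      _ ≤ Q * e + M * ‖z s - Y s‖ := norm_add_le_of_le (hζf s hs') (hf s hs')
      _ ≤ Q * e + M * (‖ζ s - Y s‖ + Q * e) := by gcongr
      _ = _ := by ring

variable {Y : ℝ → E} {F P G : E → E} {T : ℝ}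

theorem isBigO_sub_of_perturbation {ι : Type*} {l : Filter ι} {ε : ι → ℝ} {z : ι → ℝ → E}
    (hY : ∀ t ∈ Icc 0 T, HasDerivWithinAt Y (F (Y t)) (Icc 0 T) t)
    (hF : ∀ t ∈ Icc 0 T, ContDiffAt ℝ 1 F (Y t)) (hP : ∀ t ∈ Icc 0 T, ContinuousAt P (Y t))
    (hG : ∀ t ∈ Icc 0 T, ContinuousAt G (Y t)) (hε : Tendsto ε l (𝓝 0))
    (hz : ∀ᶠ i in l, ContinuousOn (z i) (Icc 0 T))
    (hz' : ∀ᶠ i in l, ∀ t ∈ Icc 0 T, HasDerivWithinAt (fun s => z i s + ε i • P (z i s))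
      (F (z i t) + ε i • G (z i t)) (Icc 0 T) t)
    (hz₀ : (fun i => z i 0 - Y 0) =O[l] ε) :
    (fun q : ι × ℝ => z q.1 q.2 - Y q.2) =O[l ×ˢ 𝓟 (Icc 0 T)] fun q => ε q.1 := by
  have hYc : ContinuousOn Y (Icc 0 T) := fun t ht => (hY t ht).continuousWithinAt
  obtain ⟨M, hM0, δ₁, hδ₁, hM⟩ := exists_norm_sub_le_near_orbit (Ψ := fun q => F q.2) hYc
    fun t ht => (hF t ht).fun_comp (f := Prod.snd) ((0 : ℝ), Y t) contDiffAt_snd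
  obtain ⟨Q, hQ0, δ₂, hδ₂, hQ⟩ := exists_norm_le_near_orbit (H := fun w => (P w, G w)) hYc
    fun t ht => (hP t ht).prodMk (hG t ht)
  obtain ⟨D, hD0, hD⟩ := hz₀.exists_nonneg
  set C := gronwallBound (D + Q) M ((M + 1) * Q) T + Q
  have hnorm : Tendsto (fun i => ‖ε i‖) l (𝓝 0) := by simpa using hε.norm
  have hsmall (B : ℝ) : ∀ᶠ i in l, B * ‖ε i‖ < min δ₁ δ₂ :=
    (hnorm.const_mul B).eventually_lt_const (by simp [hδ₁, hδ₂])
  refine .of_bound C (eventually_prod_principal_iff.2 ?_)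
  filter_upwards [hz, hz', hD.bound, hsmall C, hsmall D] with i hzi hzi' hDi hCi hDi'
  refine le_of_continuousOn_of_forall_lt_imp_le (d := fun t => ‖z i t - Y t‖) (hzi.sub hYc).norm
    hCi (hDi.trans_lt hDi') fun t ht hnear => ?_
  have hsub : Icc 0 t ⊆ Icc 0 T := Icc_subset_Icc_right ht.2
  have hPG (s : ℝ) (hs : s ∈ Icc 0 t) := hQ s (hsub hs) (z i s) ((lt_min_iff.1 (hnear s hs)).2)
  refine (norm_sub_le_gronwallBound_of_perturbation (Y' := fun s => F (Y s))
    (f := fun s => F (z i s)) (D := D) (M := M) (Q := Q) hM0 ht.1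
    (fun s hs => (hY s (hsub hs)).mono hsub) (fun s hs => (hzi' s (hsub hs)).mono hsub)
    (fun s hs => ?_) (fun s hs => ?_) (fun s hs => ?_) hDi).trans ?_
  · simpa using hM s (hsub hs) 0 (z i s) (by simpa) (lt_min_iff.1 (hnear s hs)).1
  · rw [add_sub_cancel_left, norm_smul, mul_comm]
    gcongr
    exact (norm_fst_le _).trans (hPG s hs)
  · rw [add_sub_cancel_left, norm_smul, mul_comm]
    gcongr
    exact (norm_snd_le _).trans (hPG s hs)
  · gcongr
    exact add_le_add_left (gronwallBound_mono (by positivity) (by positivity) hM0 ht.2) Q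

theorem isBigO_sub_of_hasDerivWithinAt {ι : Type*} {l : Filter ι} {ε : ι → ℝ} {f f' : ι → ℝ → E}
    (hT : 0 ≤ T) (hf : ∀ᶠ i in l, ∀ t ∈ Icc 0 T, HasDerivWithinAt (f i) (f' i t) (Icc 0 T) t)
    (hf' : (fun q : ι × ℝ => f' q.1 q.2) =O[l ×ˢ 𝓟 (Icc 0 T)] fun q => ε q.1) :
    (fun i => f i T - f i 0) =O[l] ε := by
  obtain ⟨C, hC⟩ := hf'.bound
  refine .of_bound (C * T) ?_
  filter_upwards [hf, eventually_prod_principal_iff.1 hC] with i hfi hCi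
  refine (norm_image_sub_le_of_norm_deriv_le_segment' (C := C * ‖ε i‖) hfi
    (fun t ht => hCi t ⟨ht.1, ht.2.le⟩) T ⟨hT, le_rfl⟩).trans (le_of_eq (by ring))

end Perturbation

/-! ### The Euler-Lagrange equation of the modified Lagrangian -/

theorem hasGradientAt_of_hasLineDerivAt {E : Type*} [NormedAddCommGroup E] [InnerProductSpace ℝ E]
    [CompleteSpace E] {f : E → ℝ} {g x : E} (hf : DifferentiableAt ℝ f x)
    (hg : ∀ d, HasLineDerivAt ℝ f ⟪g, d⟫ x d) : HasGradientAt f g x :=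
  hasGradientAt_iff_hasFDerivAt.2 (hf.hasFDerivAt.congr_fderiv (ContinuousLinearMap.ext fun d =>
    (hf.hasFDerivAt.hasLineDerivAt d).unique (hg d)))

/-- The coefficient of `h²` in the momentum `∂L/∂v` of the modified Lagrangian `L`. -/
noncomputable def momentumCorrection (x v : Plane) : Plane :=
  (⟪x, v⟫ / (2 * ‖x‖ ^ 5)) • x - (6 * ‖x‖ ^ 3)⁻¹ • v

/-- The momentum `∂L/∂v` of the modified Lagrangian `L` with step size `h`. -/
noncomputable def modMomentum (h : ℝ) (x v : Plane) : Plane := v + h ^ 2 • momentumCorrection x v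

/-- The coefficient of `h²` in the force `∂L/∂x` of the modified Lagrangian `L`. -/
noncomputable def forceCorrection (x v : Plane) : Plane :=
  (‖v‖ ^ 2 / (4 * ‖x‖ ^ 5) - (6 * ‖x‖ ^ 6)⁻¹ - 5 * ⟪x, v⟫ ^ 2 / (4 * ‖x‖ ^ 7)) • x +
    (⟪x, v⟫ / (2 * ‖x‖ ^ 5)) • v

theorem hasGradientAt_svModLagrangian_vel (h : ℝ) (x v : Plane) :
    HasGradientAt (fun w => svModLagrangian h x w) (modMomentum h x v) v := by
  refine hasGradientAt_of_hasLineDerivAt ?_ fun d => ?_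
  · have hnorm : DifferentiableAt ℝ (fun w : Plane => ‖w‖ ^ 2) v := differentiableAt_id.norm_sq ℝ
    have hinner : DifferentiableAt ℝ (fun w : Plane => ⟪x, w⟫) v :=
      (differentiableAt_const x).inner ℝ differentiableAt_id
    unfold svModLagrangian
    fun_prop
  · have hline := hasDerivWithinAt_line v d 0
    have hnorm := hline.norm_sq
    have hinner := hasDerivWithinAt_inner_left_const hline x
    refine (hasDerivWithinAt_univ.1 (((hnorm.const_mul (1 / 2)).add_const (1 / ‖x‖)).fun_add
      ((((hnorm.div_const (‖x‖ ^ 3)).const_mul 2).const_sub (1 / ‖x‖ ^ 4) |>.fun_add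
        (((hinner.fun_pow 2).div_const (‖x‖ ^ 5)).const_mul 6)).const_mul
          (h ^ 2 / 24)))).congr_deriv ?_
    simp only [zero_smul, add_zero, modMomentum, momentumCorrection, inner_add_left,
      inner_sub_left, real_inner_smul_left]
    rw [mul_inv, mul_comm 2 (‖x‖ ^ 5), ← div_div]
    push_cast
    ring

theorem hasGradientAt_svModLagrangian_pos (h : ℝ) {x : Plane} (hx : x ≠ 0) (v : Plane) :
    HasGradientAt (fun y => svModLagrangian h y v)
      (keplerForce x + h ^ 2 • forceCorrection x v) x := by
  have hn : ‖x‖ ≠ 0 := norm_ne_zero_iff.2 hx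
  refine hasGradientAt_of_hasLineDerivAt ?_ fun d => ?_
  · have hnorm : DifferentiableAt ℝ (fun y : Plane => ‖y‖) x := differentiableAt_id.norm ℝ hx
    have hinner : DifferentiableAt ℝ (fun y : Plane => ⟪y, v⟫) x :=
      differentiableAt_id.inner ℝ (differentiableAt_const v)
    unfold svModLagrangian
    fun_prop (disch := positivity)
  · have hx₀ : x + (0 : ℝ) • d ≠ 0 := by simpa
    have hn₀ : ‖x + (0 : ℝ) • d‖ ≠ 0 := norm_ne_zero_iff.2 hx₀
    have hline := hasDerivWithinAt_line x d 0
    have hnorm := hasDerivWithinAt_norm hline hx₀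
    have hinner := hline.inner ℝ (hasDerivWithinAt_const 0 univ v)
    have hc (c : ℝ) := hasDerivWithinAt_const (0 : ℝ) univ c
    refine (hasDerivWithinAt_univ.1 ((((hc 1).fun_div hnorm hn₀).const_add
      (1 / 2 * ‖v‖ ^ 2)).fun_add (((((hc 1).fun_div (hnorm.fun_pow 4) (pow_ne_zero 4 hn₀)).fun_sub
        (((hc (‖v‖ ^ 2)).fun_div (hnorm.fun_pow 3) (pow_ne_zero 3 hn₀)).const_mul 2)).fun_add
          (((hinner.fun_pow 2).fun_div (hnorm.fun_pow 5) (pow_ne_zero 5 hn₀)).const_mul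
            6)).const_mul (h ^ 2 / 24)))).congr_deriv ?_
    simp only [zero_smul, add_zero, keplerForce, forceCorrection, inner_add_left, inner_neg_left,
      real_inner_smul_left, real_inner_comm d v, inner_zero_right, zero_add]
    field_simp
    push_cast
    ring

theorem angularMomentum_modMomentum (h : ℝ) (x v : Plane) :
    angularMomentum x (modMomentum h x v) =
      angularMomentum x v - h ^ 2 * (angularMomentum x v / (6 * ‖x‖ ^ 3)) := by
  simp only [modMomentum, momentumCorrection, angularMomentum_add_right,
    angularMomentum_smul_right, angularMomentum_sub_right, angularMomentum_self]
  ring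

theorem inner_forceCorrection (m : Plane) {x : Plane} (hx : x ≠ 0) (v : Plane) :
    ⟪m, forceCorrection x v⟫ = -(⟪m, x⟫ / (6 * ‖x‖ ^ 6)) - dipoleHessian m x v / 12 := by
  have hn : ‖x‖ ≠ 0 := norm_ne_zero_iff.2 hx
  simp only [forceCorrection, dipoleHessian, inner_add_right, real_inner_smul_right]
  field_simp
  ring

/-- The coefficient of `h²` in the change of `angularMomentum m (lrlVector x v)` when the velocity
`v` is replaced by the momentum of the modified Lagrangian. -/
noncomputable def lrlShift (m x v : Plane) : ℝ :=
  angularMomentum x v / (6 * ‖x‖ ^ 3) * ⟪m, v⟫ -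
    angularMomentum x v * ⟪m, momentumCorrection x v⟫

theorem angularMomentum_lrlVector_modMomentum (m : Plane) (h : ℝ) (x v : Plane) :
    angularMomentum m (lrlVector x (modMomentum h x v)) =
      angularMomentum m (lrlVector x v) + h ^ 2 * lrlShift m x v +
        h ^ 4 * (angularMomentum x v / (6 * ‖x‖ ^ 3) * ⟪m, momentumCorrection x v⟫) := by
  rw [angularMomentum_lrlVector, angularMomentum_lrlVector, angularMomentum_modMomentum,
    modMomentum, inner_add_right, real_inner_smul_right, lrlShift]
  ring

namespace IsEulerLagrangeSolution

theorem continuousOn_state {L : Plane → Plane → ℝ} {T : ℝ} {x v : ℝ → Plane}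
    (hx : IsEulerLagrangeSolution L T x v) : ContinuousOn (fun t => (x t, v t)) (Icc 0 T) :=
  ContinuousOn.prodMk (fun t ht => (hx.hasDeriv t ht).continuousWithinAt)
    hx.contDiffOn_vel.continuousOn

variable {h T : ℝ} {x v : ℝ → Plane} (hx : IsEulerLagrangeSolution (svModLagrangian h) T x v)
include hx

theorem hasDerivWithinAt_modMomentum {t : ℝ} (ht : t ∈ Icc 0 T) :
    HasDerivWithinAt (fun s => modMomentum h (x s) (v s))
      (keplerForce (x t) + h ^ 2 • forceCorrection (x t) (v t)) (Icc 0 T) t := by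
  have hEL := hx.eulerLagrange t ht
  rwa [(hasGradientAt_svModLagrangian_pos h (hx.ne_zero t ht) (v t)).gradient,
    funext fun s => (hasGradientAt_svModLagrangian_vel h (x s) (v s)).gradient] at hEL

theorem angularMomentum_modMomentum_eq {t : ℝ} (ht : t ∈ Icc 0 T) :
    angularMomentum (x t) (modMomentum h (x t) (v t)) =
      angularMomentum (x 0) (modMomentum h (x 0) (v 0)) := by
  have hderiv (t : ℝ) (ht : t ∈ Icc 0 T) : HasDerivWithinAt
      (fun t => angularMomentum (x t) (modMomentum h (x t) (v t))) 0 (Icc 0 T) t := by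
    refine (hasDerivWithinAt_angularMomentum (hx.hasDeriv t ht)
      (hx.hasDerivWithinAt_modMomentum ht)).congr_deriv ?_
    simp only [modMomentum, momentumCorrection, forceCorrection, angularMomentum_add_right,
      angularMomentum_smul_right, angularMomentum_sub_right, angularMomentum_self,
      angularMomentum_keplerForce]
    simp only [angularMomentum]
    ring
  have hconst := norm_image_sub_le_of_norm_deriv_le_segment' (C := 0) hderiv (by simp) t ht
  rwa [zero_mul, norm_le_zero_iff, sub_eq_zero] at hconst

theorem hasDerivWithinAt_angularMomentum_lrlVector (m : Plane) {t : ℝ} (ht : t ∈ Icc 0 T) :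
    HasDerivWithinAt (fun s => angularMomentum m (lrlVector (x s) (modMomentum h (x s) (v s))))
      (h ^ 2 / 12 * (angularMomentum (x t) (v t) * dipoleHessian m (x t) (v t)) -
        h ^ 4 * (angularMomentum (x t) (v t) * (⟪m, x t⟫ / (6 * ‖x t‖ ^ 6) +
          dipoleHessian m (x t) (v t) / 12) / (6 * ‖x t‖ ^ 3))) (Icc 0 T) t := by
  have hx₀ := hx.ne_zero t ht
  have hn : ‖x t‖ ≠ 0 := norm_ne_zero_iff.2 hx₀
  simp only [angularMomentum_lrlVector]
  refine (((((hasDerivWithinAt_inner_left_const (hx.hasDerivWithinAt_modMomentum ht) m).const_mul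
    (angularMomentum (x t) (modMomentum h (x t) (v t)))).fun_neg.fun_sub
      (hasDerivWithinAt_angularMomentum_unit (hx.hasDeriv t ht) hx₀ m)).congr_of_mem
        (fun s hs => ?_) ht)).congr_deriv ?_
  · rw [hx.angularMomentum_modMomentum_eq hs, hx.angularMomentum_modMomentum_eq ht]
  · rw [inner_add_right, real_inner_smul_right, inner_keplerForce, inner_forceCorrection m hx₀,
      angularMomentum_modMomentum]
    field_simp
    ring

end IsEulerLagrangeSolution

section Smoothness

variable {y : Plane × Plane} (hy : y.1 ≠ 0) {n : WithTop ℕ∞}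
include hy

theorem contDiffAt_momentumCorrection :
    ContDiffAt ℝ n (fun y : Plane × Plane => momentumCorrection y.1 y.2) y := by
  have : ‖y.1‖ ≠ 0 := norm_ne_zero_iff.2 hy
  have hn : ContDiffAt ℝ n (fun y : Plane × Plane => ‖y.1‖) y := contDiffAt_fst.norm ℝ hy
  have hxv : ContDiffAt ℝ n (fun y : Plane × Plane => ⟪y.1, y.2⟫) y :=
    contDiffAt_fst.inner ℝ contDiffAt_snd
  exact ((hxv.div (contDiffAt_const.mul (hn.pow 5)) (by positivity)).smul contDiffAt_fst).sub
    (((contDiffAt_const.mul (hn.pow 3)).inv (by positivity)).smul contDiffAt_snd)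

theorem continuousAt_forceCorrection :
    ContinuousAt (fun y : Plane × Plane => forceCorrection y.1 y.2) y := by
  have : ‖y.1‖ ≠ 0 := norm_ne_zero_iff.2 hy
  unfold forceCorrection
  fun_prop (disch := positivity)

theorem contDiffAt_lrlShift (m : Plane) :
    ContDiffAt ℝ n (fun y : Plane × Plane => lrlShift m y.1 y.2) y := by
  have : ‖y.1‖ ≠ 0 := norm_ne_zero_iff.2 hy
  have hn : ContDiffAt ℝ n (fun y : Plane × Plane => ‖y.1‖) y := contDiffAt_fst.norm ℝ hy
  have hl : ContDiffAt ℝ n (fun y : Plane × Plane => angularMomentum y.1 y.2) y :=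
    contDiff_angularMomentum.contDiffAt
  exact ((hl.div (contDiffAt_const.mul (hn.pow 3)) (by positivity)).mul
    (contDiffAt_const.inner ℝ contDiffAt_snd)).sub
      (hl.mul (contDiffAt_const.inner ℝ (contDiffAt_momentumCorrection hy)))

end Smoothness

/-! ### Precession of the modified Lagrangian -/

section ModifiedLagrangian

variable {ι : Type*} {l : Filter ι} {h : ι → ℝ} {x v : ι → ℝ → Plane} {X V : ℝ → Plane} {T : ℝ}

theorem isBigO_eval_of_prod_principal {α E F : Type*} [Norm E] [Norm F] {s : Set α}
    {f : ι × α → E} {g : ι → F} (hf : f =O[l ×ˢ 𝓟 s] fun q => g q.1) {t : α} (ht : t ∈ s) :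
    (fun i => f (i, t)) =O[l] g :=
  hf.comp_tendsto (tendsto_id.prodMk (tendsto_principal.2 (.of_forall fun _ => ht)))

theorem tendsto_step_pow_prod {s : Set ℝ} (hh : Tendsto h l (𝓝 0)) {n : ℕ} (hn : n ≠ 0) :
    Tendsto (fun q : ι × ℝ => h q.1 ^ n) (l ×ˢ 𝓟 s) (𝓝 0) := by
  simpa [hn] using (hh.comp tendsto_fst).pow n

variable (hX : IsKeplerSolution X V) (hh : Tendsto h l (𝓝 0))
  (hx : ∀ᶠ i in l, IsEulerLagrangeSolution (svModLagrangian (h i)) T (x i) (v i))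
  (hz₀ : (fun i => (x i 0, v i 0) - (X 0, V 0)) =O[l] fun i => h i ^ 2)
include hX hh hx hz₀

theorem isBigO_modState_sub :
    (fun q : ι × ℝ => (x q.1 q.2, v q.1 q.2) - (X q.2, V q.2)) =O[l ×ˢ 𝓟 (Icc 0 T)]
      fun q => h q.1 ^ 2 := by
  refine isBigO_sub_of_perturbation (Y := fun t => (X t, V t)) (F := keplerField)
    (z := fun i t => (x i t, v i t))
    (P := fun y : Plane × Plane => (0, momentumCorrection y.1 y.2))
    (G := fun y : Plane × Plane => (0, forceCorrection y.1 y.2))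
    (fun t _ => (hX.hasDerivAt_phase t).hasDerivWithinAt)
    (fun t _ => contDiffAt_keplerField (hX.ne_zero t))
    (fun t _ => continuousAt_const.prodMk
      (contDiffAt_momentumCorrection (n := 0) (hX.ne_zero t)).continuousAt)
    (fun t _ => continuousAt_const.prodMk (continuousAt_forceCorrection (hX.ne_zero t)))
    (by simpa using hh.pow 2) (hx.mono fun i hi => hi.continuousOn_state) ?_ hz₀
  filter_upwards [hx] with i hi t ht
  simpa [keplerField, modMomentum] using
    (hi.hasDeriv t ht).prodMk (hi.hasDerivWithinAt_modMomentum ht)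

theorem isBigO_comp_modState_sub {F : Type*} [NormedAddCommGroup F] [NormedSpace ℝ F]
    {g : Plane × Plane → F} (hg : ∀ t, ContDiffAt ℝ 1 g (X t, V t)) :
    (fun q : ι × ℝ => g (x q.1 q.2, v q.1 q.2) - g (X q.2, V q.2)) =O[l ×ˢ 𝓟 (Icc 0 T)]
      fun q => h q.1 ^ 2 := by
  have hstate := isBigO_modState_sub hX hh hx hz₀
  refine (isBigO_comp_sub_comp (g := g) (hX.isCompact_phase T) ?_
    (eventually_prod_principal_iff.2 (.of_forall fun _ t ht => mem_image_of_mem _ ht))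
    (hstate.trans_tendsto (tendsto_step_pow_prod hh two_ne_zero))
    (w := fun q => (X q.2, V q.2)) (by simpa only [sub_self] using tendsto_const_nhds)).trans hstate
  rintro _ ⟨t, -, rfl⟩
  exact hg t

theorem isBigO_comp_modState_one {F : Type*} [SeminormedAddCommGroup F]
    {g : Plane × Plane → F} (hg : ∀ t, ContinuousAt g (X t, V t)) :
    (fun q : ι × ℝ => g (x q.1 q.2, v q.1 q.2)) =O[l ×ˢ 𝓟 (Icc 0 T)] fun _ => (1 : ℝ) := by
  refine isBigO_comp_one (hX.isCompact_phase T) ?_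
    (eventually_prod_principal_iff.2 (.of_forall fun _ t ht => mem_image_of_mem _ ht))
    ((isBigO_modState_sub hX hh hx hz₀).trans_tendsto (tendsto_step_pow_prod hh two_ne_zero))
  rintro _ ⟨t, -, rfl⟩
  exact hg t

theorem isBigO_angularMomentum_lrlVector_modMomentum_sub (hT : 0 ≤ T) {m : Plane} {W : ℝ → ℝ}
    (hW : ∀ t, HasDerivAt W (dipoleHessian m (X t) (V t)) t) :
    (fun i => angularMomentum m (lrlVector (x i T) (modMomentum (h i) (x i T) (v i T))) -
        angularMomentum m (lrlVector (x i 0) (modMomentum (h i) (x i 0) (v i 0))) -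
        h i ^ 2 * (angularMomentum (X 0) (V 0) / 12) * (W T - W 0)) =O[l] fun i => h i ^ 4 := by
  have hdrift := isBigO_comp_modState_sub hX hh hx hz₀
    (g := fun y : Plane × Plane => angularMomentum y.1 y.2 * dipoleHessian m y.1 y.2) fun t =>
      contDiff_angularMomentum.contDiffAt.mul (contDiffAt_dipoleHessian m (hX.ne_zero t))
  have hscale := ((isBigO_refl (fun q : ι × ℝ => h q.1 ^ 2) (l ×ˢ 𝓟 (Icc 0 T))).const_mul_left
    12⁻¹).mul hdrift
  have hrem := isBigO_comp_modState_one hX hh hx hz₀ (g := fun y : Plane × Plane =>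
    angularMomentum y.1 y.2 * (⟪m, y.1⟫ / (6 * ‖y.1‖ ^ 6) + dipoleHessian m y.1 y.2 / 12) /
      (6 * ‖y.1‖ ^ 3)) fun t => by
    have hn : ‖X t‖ ≠ 0 := norm_ne_zero_iff.2 (hX.ne_zero t)
    have hl := (contDiff_angularMomentum (n := 0)).continuous.continuousAt (x := (X t, V t))
    have hD := (contDiffAt_dipoleHessian (n := 0) m (y := (X t, V t)) (hX.ne_zero t)).continuousAt
    exact (hl.mul ((ContinuousAt.div (by fun_prop) (by fun_prop) (by positivity)).add
      (hD.div_const 12))).div (by fun_prop) (by positivity)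
  have hrem' := (isBigO_refl (fun q : ι × ℝ => h q.1 ^ 4) (l ×ˢ 𝓟 (Icc 0 T))).mul hrem
  refine (isBigO_sub_of_hasDerivWithinAt hT (f := fun i t =>
    angularMomentum m (lrlVector (x i t) (modMomentum (h i) (x i t) (v i t))) -
      h i ^ 2 * (angularMomentum (X 0) (V 0) / 12) * W t) (hx.mono fun i hi t ht =>
        (hi.hasDerivWithinAt_angularMomentum_lrlVector m ht).fun_sub
          ((hW t).hasDerivWithinAt.const_mul _)) ?_).congr_left fun i => by ring
  refine ((hscale.congr_right (g₂ := fun q => h q.1 ^ 4) fun q => by ring).sub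
    (hrem'.congr_right fun q => mul_one _)).congr_left fun q => ?_
  rw [hX.angularMomentum_eq]
  ring

theorem isBigO_lrlShift_sub (hT : 0 ≤ T) (hper : Function.Periodic X T) (m : Plane) :
    (fun i => lrlShift m (x i T) (v i T) - lrlShift m (x i 0) (v i 0)) =O[l]
      fun i => h i ^ 2 := by
  have hshift := isBigO_comp_modState_sub hX hh hx hz₀ fun t =>
    contDiffAt_lrlShift (y := (X t, V t)) (hX.ne_zero t) m
  refine ((isBigO_eval_of_prod_principal hshift (right_mem_Icc.2 hT)).sub
    (isBigO_eval_of_prod_principal hshift (left_mem_Icc.2 hT))).congr_left fun i => ?_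
  simp only [hper.eq, hX.vel_eq_of_periodic hper]
  ring

theorem isBigO_angularMomentum_lrlVector_sub (hT : 0 ≤ T) (hper : Function.Periodic X T)
    {m : Plane} {W : ℝ → ℝ} (hW : ∀ t, HasDerivAt W (dipoleHessian m (X t) (V t)) t) :
    (fun i => angularMomentum m (lrlVector (x i T) (v i T)) -
        angularMomentum m (lrlVector (x i 0) (v i 0)) -
        h i ^ 2 * (angularMomentum (X 0) (V 0) / 12) * (W T - W 0)) =O[l] fun i => h i ^ 4 := by
  have hrem := isBigO_comp_modState_one hX hh hx hz₀ (g := fun y : Plane × Plane =>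
    angularMomentum y.1 y.2 / (6 * ‖y.1‖ ^ 3) * ⟪m, momentumCorrection y.1 y.2⟫) fun t => by
    have hn : ‖X t‖ ≠ 0 := norm_ne_zero_iff.2 (hX.ne_zero t)
    have hl := (contDiff_angularMomentum (n := 0)).continuous.continuousAt (x := (X t, V t))
    have hp := (contDiffAt_momentumCorrection (n := 0) (y := (X t, V t))
      (hX.ne_zero t)).continuousAt
    exact (hl.div (by fun_prop) (by positivity)).mul (continuousAt_const.inner hp)
  have hrem' := (isBigO_refl (fun i => h i ^ 4) l).mul
    ((isBigO_eval_of_prod_principal (g := fun _ => (1 : ℝ)) hrem (right_mem_Icc.2 hT)).sub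
      (isBigO_eval_of_prod_principal hrem (left_mem_Icc.2 hT)))
  have hshift := (isBigO_refl (fun i => h i ^ 2) l).mul
    (isBigO_lrlShift_sub hX hh hx hz₀ hT hper m)
  refine (((isBigO_angularMomentum_lrlVector_modMomentum_sub hX hh hx hz₀ hT hW).sub
    (hshift.congr_right fun i => by ring)).sub
      (hrem'.congr_right fun i => mul_one _)).congr_left fun i => ?_
  simp only [angularMomentum_lrlVector_modMomentum]
  ring

theorem isBigO_modLrl_sub :
    (fun q : ι × ℝ => lrlVector (x q.1 q.2) (v q.1 q.2) - lrlVector (X 0) (V 0))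
      =O[l ×ˢ 𝓟 (Icc 0 T)] fun q => h q.1 ^ 2 :=
  (isBigO_comp_modState_sub hX hh hx hz₀ fun t =>
    contDiffAt_lrlVector (y := (X t, V t)) (hX.ne_zero t)).congr_left fun q => by
      rw [hX.lrlVector_eq]

theorem isBigO_lrlAngle_sub (hm : lrlVector (X 0) (V 0) ≠ 0) (hT : 0 ≤ T)
    (hper : Function.Periodic X T) {W : ℝ → ℝ}
    (hW : ∀ t, HasDerivAt W (dipoleHessian (lrlVector (X 0) (V 0)) (X t) (V t)) t)
    {θ : ι → ℝ → ℝ} (hθ : ∀ᶠ i in l, IsLrlAngle T (x i) (v i) (θ i)) :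
    (fun i => θ i T - θ i 0 -
        h i ^ 2 * (angularMomentum (X 0) (V 0) / 12 * (W T - W 0) / ‖lrlVector (X 0) (V 0)‖ ^ 2))
      =O[l] fun i => h i ^ 4 := by
  have h0 : (0 : ℝ) ∈ Icc 0 T := left_mem_Icc.2 hT
  have h1 : T ∈ Icc 0 T := right_mem_Icc.2 hT
  have hlrl := isBigO_modLrl_sub hX hh hx hz₀
  have hstep := tendsto_step_pow_prod (s := Icc 0 T) hh two_ne_zero
  have hangle := (isBigO_signedAngle_sub hm hlrl hstep).congr_right
    (g₂ := fun q => h q.1 ^ 4) fun q => by ring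
  have hnear := (hlrl.trans_tendsto hstep).norm.eventually_lt_const
    (by simpa using hm : ‖(0 : Plane)‖ < ‖lrlVector (X 0) (V 0)‖)
  have hdrift := (isBigO_angularMomentum_lrlVector_sub hX hh hx hz₀ hT hper hW).const_mul_left
    (‖lrlVector (X 0) (V 0)‖ ^ 2)⁻¹
  refine (((isBigO_eval_of_prod_principal (g := fun i => h i ^ 4) hangle h1).sub
    (isBigO_eval_of_prod_principal hangle h0)).add hdrift).congr' ?_ .rfl
  filter_upwards [hx, hθ, eventually_prod_principal_iff.1 hnear] with i hxi hθi hneari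
  have hlrlc : ContinuousOn (fun t => lrlVector (x i t) (v i t)) (Icc 0 T) := fun t ht =>
    ContinuousAt.comp_continuousWithinAt (f := fun t => (x i t, v i t))
      (contDiffAt_lrlVector (n := 0) (hxi.ne_zero t ht)).continuousAt
      (hxi.continuousOn_state t ht)
  rw [continuous_angle_sub_eq isPreconnected_Icc hlrlc hθi.1 hneari hθi.2 h0 h1]
  ring

end ModifiedLagrangian

/-! ### Uniformity over the admissible initial values -/

theorem exists_eventually_forall_norm_le {α β E F : Type*} [Norm E] [Norm F] {l : Filter α}
    {P : α → β → Prop} {f : α → β → E} {g : α → F}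
    (hf : (fun q : {q : α × β // P q.1 q.2} => f q.1.1 q.1.2) =O[comap (fun q => q.1.1) l]
      fun q => g q.1.1) :
    ∃ C : ℝ, ∀ᶠ a in l, ∀ b, P a b → ‖f a b‖ ≤ C * ‖g a‖ := by
  obtain ⟨C, hC⟩ := hf.bound
  exact ⟨C, (eventually_comap.1 hC).mono fun a ha b hb => ha ⟨(a, b), hb⟩ rfl⟩

theorem isBigO_of_norm_le_mul {α E : Type*} [Norm E] {l : Filter α} {f : α → E} {g : α → ℝ} {K : ℝ}
    (hf : ∀ q, ‖f q‖ ≤ K * g q) : f =O[l] g :=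
  .of_bound |K| (.of_forall fun q => (hf q).trans ((le_abs_self _).trans_eq (abs_mul K (g q))))

section Uniform

variable {X V : ℝ → Plane} (hX : IsKeplerSolution X V) (hm : lrlVector (X 0) (V 0) ≠ 0)
  {T : ℝ} (hT : 0 ≤ T) {W : ℝ → ℝ}
  (hW : ∀ t, HasDerivAt W (dipoleHessian (lrlVector (X 0) (V 0)) (X t) (V t)) t) (K : ℝ)
include hX hm hT hW

theorem exists_eventually_norm_svPrecession_sub_le :
    ∃ C : ℝ, ∀ᶠ h in 𝓝[>] 0, ∀ x : ℕ → Plane, IsStormerVerlet h x ∧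
      ‖x 0 - X 0‖ ≤ K * h ^ 2 ∧ ‖svMomentum h x 0 - V 0‖ ≤ K * h ^ 2 →
      ‖svPrecession h x T - h ^ 2 * (angularMomentum (X 0) (V 0) / 12 * (W T - W 0) /
        ‖lrlVector (X 0) (V 0)‖ ^ 2)‖ ≤ C * ‖h ^ 4‖ := by
  exact exists_eventually_forall_norm_le (g := fun h : ℝ => h ^ 4)
    (isBigO_svPrecession_sub hX tendsto_comap (.of_forall fun q => q.2.1)
      ((isBigO_of_norm_le_mul fun q => q.2.2.1).prod_left
        (isBigO_of_norm_le_mul fun q => q.2.2.2)) hm hT hW)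

theorem exists_eventually_norm_lrlAngle_sub_le (hper : Function.Periodic X T) :
    ∃ C : ℝ, ∀ᶠ h in 𝓝[>] 0, ∀ y : (ℝ → Plane) × (ℝ → Plane) × (ℝ → ℝ),
      IsEulerLagrangeSolution (svModLagrangian h) T y.1 y.2.1 ∧ ‖y.1 0 - X 0‖ ≤ K * h ^ 2 ∧
        ‖y.2.1 0 - V 0‖ ≤ K * h ^ 2 ∧ IsLrlAngle T y.1 y.2.1 y.2.2 →
      ‖y.2.2 T - y.2.2 0 - h ^ 2 * (angularMomentum (X 0) (V 0) / 12 * (W T - W 0) /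
        ‖lrlVector (X 0) (V 0)‖ ^ 2)‖ ≤ C * ‖h ^ 4‖ := by
  exact exists_eventually_forall_norm_le (g := fun h : ℝ => h ^ 4)
    (isBigO_lrlAngle_sub hX (tendsto_comap.mono_right nhdsWithin_le_nhds)
      (.of_forall fun q => q.2.1) ((isBigO_of_norm_le_mul fun q => q.2.2.1).prod_left
        (isBigO_of_norm_le_mul fun q => q.2.2.2.1)) hm hT hper hW
          (.of_forall fun q => q.2.2.2.2))

end Uniform

theorem mainTheorem1 (X V : ℝ → Plane) (hX : IsKeplerSolution X V)
    (a b T : ℝ) (horbit : IsEllipse (Set.range X) a b) (hba : b < a)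
    (hT : IsMinimalPeriod X T) (K : ℝ) :
    ∃ C h₀ : ℝ, 0 < h₀ ∧ ∀ h : ℝ, 0 < h → h < h₀ →
      (∀ x : ℕ → Plane, IsStormerVerlet h x →
        ‖x 0 - X 0‖ ≤ K * h ^ 2 → ‖svMomentum h x 0 - V 0‖ ≤ K * h ^ 2 →
        |svPrecession h x T -
            -(Real.sign (angularMomentum (X 0) (V 0)) * (Real.pi / 24) *
              (15 * (a ^ 3 / b ^ 6) - 3 * (a / b ^ 4)) * h ^ 2)| ≤ C * h ^ 4) ∧
      (∀ (x v : ℝ → Plane) (θ : ℝ → ℝ), IsEulerLagrangeSolution (svModLagrangian h) T x v →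
        ‖x 0 - X 0‖ ≤ K * h ^ 2 → ‖v 0 - V 0‖ ≤ K * h ^ 2 → IsLrlAngle T x v θ →
        |θ T - θ 0 -
            -(Real.sign (angularMomentum (X 0) (V 0)) * (Real.pi / 24) *
              (15 * (a ^ 3 / b ^ 6) - 3 * (a / b ^ 4)) * h ^ 2)| ≤ C * h ^ 4) := by
  obtain ⟨W, hW, hrate⟩ := hX.exists_primitive_dipoleHessian_of_isEllipse horbit hba hT
  obtain ⟨⟨hT0, hper⟩, -⟩ := hT
  have hm := hX.lrlVector_ne_zero horbit hba
  obtain ⟨C₁, hsv⟩ := exists_eventually_norm_svPrecession_sub_le hX hm hT0.le hW K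
  obtain ⟨C₂, hmod⟩ := exists_eventually_norm_lrlAngle_sub_le hX hm hT0.le hW K hper
  obtain ⟨h₀, hh₀, hsub⟩ := mem_nhdsGT_iff_exists_Ioo_subset.1 (hsv.and hmod)
  refine ⟨max C₁ C₂, h₀, hh₀, fun h hpos hlt => ?_⟩
  have hpow : 0 ≤ h ^ 4 := by positivity
  obtain ⟨hsv, hmod⟩ := hsub ⟨hpos, hlt⟩
  rw [← neg_mul, ← hrate, mul_comm (_ / _) (h ^ 2), max_mul_of_nonneg _ _ hpow]
  simp only [Real.norm_eq_abs, abs_of_nonneg hpow] at hsv hmod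
  exact ⟨fun x hx hx₀ hp₀ => le_max_of_le_left (hsv x ⟨hx, hx₀, hp₀⟩),
    fun x v θ hx hx₀ hv₀ hθ => le_max_of_le_right (hmod (x, v, θ) ⟨hx, hx₀, hv₀, hθ⟩)⟩
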